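/- Let $n\ge 1$ and let $\mathcal U^+$ be the $\mathbb Q(v)$-algebra with generators $E_1,\dots,E_n$ and relations $E_iE_j=E_jE_i$ for $|i-j|\ge 2$ and $E_i^2E_j-(v+v^{-1})E_iE_jE_i+E_jE_i^2=0$ for $|i-j|=1$. Put $E_0=E_{n+1}=1$. Let $[m]=\frac{v^m-v^{-m}}{v-v^{-1}}$, $[m]!=[1]\cdots[m]$, $x^{(m)}=x^m/[m]!$, and $\left[{a\atop m}\right]=\prod_{i=1}^m\frac{v^{a+1-i}-v^{-a-1+i}}{v^i-v^{-i}}$ for $a\in\mathbb Z$, $m\in\mathbb N$. Let $E_{i,i}=E_i$ and $E_{i,j}=E_iE_{i+1,j}-v^{-1}E_{i+1,j}E_i$ for $1\le i<j\le n$. The PBW elements of $\mathcal U^+$ are, for all families $(m_{i,j})_{1\le i\le j\le n}$ of non-negative integers, the products of the $E_{i,j}^{(m_{i,j})}$ taken with $i$ decreasing from $n$ to $1$ and, for each $i$, with $j$ decreasing from $n$ to $i$. In particular, for non-negative integers ${\bf r}=(r_1,\dots,r_{n-1})$, ${\bf h}=(h_1,\dots,h_n)$, $$E({\bf r},{\bf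 h})=E_n^{(h_n)}E_{n-1,n}^{(r_{n-1})}E_{n-1}^{(h_{n-1})}\cdots E_2^{(h_2)}E_{1,2}^{(r_1)}E_1^{(h_1)}$$ is a PBW element. Fix such ${\bf r},{\bf h}$, set $r_0=r_n=0$, let $\Omega=\{i\in\{1,\dots,n\}: h_i\ne 0\}=\{i_1<\dots<i_s\}$, and assume that $\Omega$ is sparse, i.e. $i\notin\Omega$ or $i+1\notin\Omega$ for all $1\le i\le n-1$. Let $$B_{i,j}=E_{j-1}^{(r_{j-1})}E_j^{(r_{j-1})}\cdots E_{i+1}^{(r_{i+1})}E_{i+2}^{(r_{i+1})}E_i^{(r_i)}E_{i+1}^{(r_i)}\quad(\text{equal to }1\text{ if } j\le i),$$ $$C_i=\sum_{u=0}^{r_i}\left[{-h_i\atop u}\right]E_i^{(r_i-u)}E_{i+1}^{(r_i)}E_{i-1}^{(r_{i-1})}E_i^{(h_i+r_{i-1}+u)},$$ $$\mathcal E_\Omega({\bf r},{\bf h})=B_{i_s+1,n}\,C_{i_s}\,B_{i_{s-1}+1,i_s-1}\,C_{i_{s-1}}\cdots C_{i_2}\,B_{i_1+1,i_2-1}\,C_{i_1}\,B_{1,i_1-1}$$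 (equal to $B_{1,n}$ if $\Omega=\emptyset$). For ${\bf k}=(k_1,\dots,k_{n-1})$ set $k_0=k_n=0$ and ${\bf h}\dotplus{\bf k}=(h_i+k_{i-1}+k_i)_{1\le i\le n}$. Then the PBW elements are linearly independent over $\mathbb Q(v)$, $\mathcal E_\Omega({\bf r},{\bf h})$ is a linear combination of the elements $E({\bf r}-{\bf k},{\bf h}\dotplus{\bf k})$ with ${\bf 0}\le{\bf k}\le{\bf r}$ componentwise, and for each such ${\bf k}$ the coefficient of $E({\bf r}-{\bf k},{\bf h}\dotplus{\bf k})$ in it is $$\sum_{(t_i)_{i\in\Omega},\;0\le t_i\le\min(k_{i-1},k_i)} v^{-\sum_{i=1}^{n}k_i^2-\sum_{i\in\Omega}k_{i-1}k_i-\sum_{i\in\Omega}h_i(k_{i-1}+k_i)+\sum_{i\in\Omega}(2h_i+k_{i-1}+k_i)t_i}\prod_{i\in\Omega}\left(\left[{k_i\atop k_i-t_i}\right]\left[{k_{i-1}\atop t_i}\right]\right)\prod_{\substack{1\le i\le n\\ i\notin\Omega}}\left[{k_{i-1}+k_i\atop k_i}\right].$$ -/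

import Mathlib

/-!  Quantized enveloping algebra of type `A_n` (positive part), its PBW basis adapted to the
quiver `1 → 2 → ⋯ → n`, and the elements attached to the strata of varieties of complexes.

Conventions: vertices are the natural numbers `1, …, n`.  A tuple `(r_1, …, r_{n-1})` is a sequence
`r : ℕ → ℕ` with `r 0 = 0 = r n`; a tuple `(h_1, …, h_n)` is a sequence `h : ℕ → ℕ`.  Only the
values `r 0, …, r n` and `h 1, …, h n` are ever used. -/

noncomputable section

namespace VarCom

/-- The field `ℚ(v)`. -/
abbrev K : Type := RatFunc ℚ

/-- The indeterminate `v`. -/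
def v : K := RatFunc.X

/-- The quantum number `[m] = (v^m - v^{-m}) / (v - v^{-1})`. -/
def qnum (m : ℕ) : K := (v ^ (m : ℤ) - v ^ (-(m : ℤ))) / (v - v⁻¹)

/-- The quantum factorial `[m]! = [1] ⋯ [m]`. -/
def qfact (m : ℕ) : K := ∏ j ∈ Finset.Icc 1 m, qnum j

/-- The quantum binomial coefficient with upper entry `a ∈ ℤ` and lower entry `m ∈ ℕ`. -/
def qbinom (a : ℤ) (m : ℕ) : K :=
  ∏ i ∈ Finset.Icc 1 m,
    (v ^ (a + 1 - (i : ℤ)) - v ^ (-a - 1 + (i : ℤ))) / (v ^ (i : ℤ) - v ^ (-(i : ℤ)))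

/-- The vertices `1, …, n` of the Dynkin diagram `A_n`. -/
abbrev Vertex (n : ℕ) : Type := {i : ℕ // 1 ≤ i ∧ i ≤ n}

/-- The defining relations of `U⁺` in type `A_n`: the Cartan entry `a_{ij}` is `0` if
`|i - j| ≥ 2` and `-1` if `|i - j| = 1`. -/
inductive SerreRel (n : ℕ) : FreeAlgebra K (Vertex n) → FreeAlgebra K (Vertex n) → Prop
  | comm (i j : Vertex n) (hij : i.1 + 2 ≤ j.1 ∨ j.1 + 2 ≤ i.1) :
      SerreRel n (FreeAlgebra.ι K i * FreeAlgebra.ι K j) (FreeAlgebra.ι K j * FreeAlgebra.ι K i)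
  | serre (i j : Vertex n) (hij : i.1 + 1 = j.1 ∨ j.1 + 1 = i.1) :
      SerreRel n
        (FreeAlgebra.ι K i ^ 2 * FreeAlgebra.ι K j
          - (v + v⁻¹) • (FreeAlgebra.ι K i * FreeAlgebra.ι K j * FreeAlgebra.ι K i)
          + FreeAlgebra.ι K j * FreeAlgebra.ι K i ^ 2)
        0

/-- The positive part `U⁺` of the quantized enveloping algebra of type `A_n` over `ℚ(v)`. -/
abbrev Uplus (n : ℕ) : Type := RingQuot (SerreRel n)

/-- The Chevalley generator `E_i` for `1 ≤ i ≤ n`, with the convention `E_i = 1` for all other `i`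
(used only for `i = 0` and `i = n + 1`). -/
def E (n i : ℕ) : Uplus n :=
  if hi : 1 ≤ i ∧ i ≤ n then RingQuot.mkAlgHom K (SerreRel n) (FreeAlgebra.ι K ⟨i, hi⟩) else 1

/-- The divided power `x^{(m)} = x^m / [m]!`. -/
def divPow {n : ℕ} (x : Uplus n) (m : ℕ) : Uplus n := (qfact m)⁻¹ • x ^ m

/-- The root element for the root `e_i + ⋯ + e_{i+l}`. -/
def rootElt (n : ℕ) : ℕ → ℕ → Uplus n
  | i, 0 => E n i
  | i, l + 1 => E n i * rootElt n (i + 1) l - v⁻¹ • (rootElt n (i + 1) l * E n i)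

/-- The root element `E_{i,j}` for `i ≤ j`, so that `E_{i,i} = E_i` and
`E_{i,j} = E_i E_{i+1,j} - v⁻¹ E_{i+1,j} E_i` for `i < j`. -/
def Eroot (n i j : ℕ) : Uplus n := rootElt n i (j - i)

/-- The positive roots `e_i + ⋯ + e_j`, `1 ≤ i ≤ j ≤ n`; equivalently, the indecomposable
representations `U_{i,j}` of the quiver `1 → ⋯ → n`. -/
abbrev PosRoot (n : ℕ) : Type := {p : ℕ × ℕ // 1 ≤ p.1 ∧ p.1 ≤ p.2 ∧ p.2 ≤ n}

/-- The multiplicity `m_{i,j}` of `U_{i,j}`, extended by zero. -/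
def mult {n : ℕ} (m : PosRoot n → ℕ) (i j : ℕ) : ℕ :=
  if hp : 1 ≤ i ∧ i ≤ j ∧ j ≤ n then m ⟨(i, j), hp⟩ else 0

/-- The PBW basis element attached to the representation `⨁ U_{i,j}^{m_{i,j}}`:
the product of the `E_{i,j}^{(m_{i,j})}` with `i` decreasing from `n` to `1` and, for each `i`,
with `j` decreasing from `n` to `i`. It corresponds to the reduced expression
`(n, n-1, n, n-2, n-1, n, …, 1, …, n)`. -/
def pbw (n : ℕ) (m : PosRoot n → ℕ) : Uplus n :=
  ((List.range' 1 n).reverse.map fun i =>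
    ((List.range' i (n + 1 - i)).reverse.map fun j => divPow (Eroot n i j) (mult m i j)).prod).prod

/-- The multiplicities of `M(r,h) = ⨁_i S_i^{h_i} ⊕ ⨁_i U_{i,i+1}^{r_i}`. -/
def complexMult (n : ℕ) (r h : ℕ → ℕ) : PosRoot n → ℕ := fun p =>
  if p.1.2 = p.1.1 then h p.1.1 else if p.1.2 = p.1.1 + 1 then r p.1.1 else 0

/-- `E(r,h) = E_n^{(h_n)} E_{n-1,n}^{(r_{n-1})} E_{n-1}^{(h_{n-1})} ⋯ E_{1,2}^{(r_1)} E_1^{(h_1)}`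
(here `r_n = 0`, so the factor with index `(n, n+1)` is `1`). -/
def Ecom (n : ℕ) (r h : ℕ → ℕ) : Uplus n :=
  ((List.range' 1 n).reverse.map fun i =>
    divPow (Eroot n i (i + 1)) (r i) * divPow (E n i) (h i)).prod

/-- `h ∔ k = (h_1 + k_1, h_2 + k_1 + k_2, …, h_n + k_{n-1})`, using `k_0 = 0 = k_n`. -/
def dotPlus (h k : ℕ → ℕ) : ℕ → ℕ := fun i => h i + k (i - 1) + k i

/-- `Ω = {i = 1, …, n | h_i ≠ 0}`. -/
def Omega (n : ℕ) (h : ℕ → ℕ) : Finset ℕ := (Finset.Icc 1 n).filter fun i => h i ≠ 0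

/-- The elements `i_1 < ⋯ < i_s` of `Ω` in increasing order. -/
def omegaList (n : ℕ) (h : ℕ → ℕ) : List ℕ := (List.range' 1 n).filter fun i => h i ≠ 0

/-- `B_{i,j} = E_{j-1}^{(r_{j-1})} E_j^{(r_{j-1})} ⋯ E_i^{(r_i)} E_{i+1}^{(r_i)}`
(equal to `1` if `j ≤ i`). -/
def Belt (n : ℕ) (r : ℕ → ℕ) (i j : ℕ) : Uplus n :=
  ((List.range' i (j - i)).reverse.map fun p =>
    divPow (E n p) (r p) * divPow (E n (p + 1)) (r p)).prod

/-- `C_i = ∑_{u=0}^{r_i} [-h_i; u] E_i^{(r_i-u)} E_{i+1}^{(r_i)} E_{i-1}^{(r_{i-1})}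
E_i^{(h_i+r_{i-1}+u)}`. -/
def Celt (n : ℕ) (r h : ℕ → ℕ) (i : ℕ) : Uplus n :=
  ∑ u ∈ Finset.range (r i + 1), qbinom (-(h i : ℤ)) u •
    (divPow (E n i) (r i - u) * divPow (E n (i + 1)) (r i) *
      divPow (E n (i - 1)) (r (i - 1)) * divPow (E n i) (h i + r (i - 1) + u))

/-- For a list `i_1 < ⋯ < i_s` and a starting vertex `a`, the product
`B_{i_s+1,n} C_{i_s} B_{i_{s-1}+1,i_s-1} C_{i_{s-1}} ⋯ B_{i_1+1,i_2-1} C_{i_1} B_{a,i_1-1}`;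
for the empty list it is `B_{a,n}`. -/
def EOmegaAux (n : ℕ) (r h : ℕ → ℕ) : List ℕ → ℕ → Uplus n
  | [], a => Belt n r a n
  | i :: l, a => EOmegaAux n r h l (i + 1) * Celt n r h i * Belt n r a (i - 1)

/-- The element `ℰ_Ω(r,h)`. -/
def EOmega (n : ℕ) (r h : ℕ → ℕ) : Uplus n := EOmegaAux n r h (omegaList n h) 1

/-- The explicit coefficient: the sum over all `(t_i)_{i ∈ Ω}` with `t_i ≤ min(k_{i-1}, k_i)`. -/
def zetaCoeff (n : ℕ) (h k : ℕ → ℕ) : K :=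
  ∑ t ∈ Fintype.piFinset fun i : {i // i ∈ Omega n h} =>
      Finset.range (min (k (i.1 - 1)) (k i.1) + 1),
    v ^ (-(∑ i ∈ Finset.Icc 1 n, (k i : ℤ) ^ 2)
        - (∑ i ∈ Omega n h, (k (i - 1) : ℤ) * (k i : ℤ))
        - (∑ i ∈ Omega n h, (h i : ℤ) * ((k (i - 1) : ℤ) + (k i : ℤ)))
        + ∑ i : {i // i ∈ Omega n h},
            (2 * (h i.1 : ℤ) + (k (i.1 - 1) : ℤ) + (k i.1 : ℤ)) * (t i : ℤ))
      * (∏ i : {i // i ∈ Omega n h}, qbinom (k i.1) (k i.1 - t i) * qbinom (k (i.1 - 1)) (t i))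
      * ∏ i ∈ Finset.Icc 1 n \ Omega n h, qbinom ((k (i - 1) : ℤ) + (k i : ℤ)) (k i)

theorem divPow_zero {n : ℕ} (x : Uplus n) : divPow x 0 = 1 := by
  simp [divPow, qfact]

/-- The PBW basis element of `M(r,h)` is `E(r,h)`. -/
theorem pbw_complexMult (n : ℕ) (r h : ℕ → ℕ) (hrn : r n = 0) :
    pbw n (complexMult n r h) = Ecom n r h := by
  unfold pbw Ecom
  congr 1
  apply List.map_congr_left
  intro i hi
  have hi' : 1 ≤ i ∧ i < 1 + n := by simpa using hi
  obtain ⟨l, hl⟩ : ∃ l, n + 1 - i = l + 1 := ⟨n - i, by omega⟩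
  have hii : divPow (Eroot n i i) (mult (complexMult n r h) i i) = divPow (E n i) (h i) := by
    rw [mult, dif_pos ⟨hi'.1, le_rfl, by omega⟩]
    simp [complexMult, Eroot, rootElt]
  rw [hl, List.range'_succ, List.reverse_cons, List.map_append, List.prod_append]
  simp only [List.map_cons, List.map_nil, List.prod_cons, List.prod_nil, mul_one, hii]
  congr 1
  cases l with
  | zero =>
    have : i = n := by omega
    subst this
    simp [hrn, divPow_zero]
  | succ l =>
    rw [List.range'_succ, List.reverse_cons, List.map_append, List.prod_append]
    have h1 : mult (complexMult n r h) i (i + 1) = r i := by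
      rw [mult, dif_pos ⟨hi'.1, by omega, by omega⟩]
      simp [complexMult]
    simp only [List.map_cons, List.map_nil, List.prod_cons, List.prod_nil, mul_one, h1]
    have h2 : ((List.range' (i + 1 + 1) l).reverse.map fun j =>
        divPow (Eroot n i j) (mult (complexMult n r h) i j)).prod = 1 := by
      apply List.prod_eq_one
      intro x hx
      obtain ⟨j, hj, rfl⟩ := List.mem_map.1 hx
      have hj' : i + 1 + 1 ≤ j ∧ j < i + 1 + 1 + l := by simpa using hj
      have : mult (complexMult n r h) i j = 0 := by
        rw [mult, dif_pos ⟨hi'.1, by omega, by omega⟩]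
        have a1 : j ≠ i := by omega
        have a2 : j ≠ i + 1 := by omega
        simp [complexMult, a1, a2]
      rw [this, divPow_zero]
    rw [h2, one_mul]

end VarCom

end

/-! Expansion. Put x = E_i, y = E_{i+1}, z = E_{i,i+1}. The Serre relations say exactly that xz = v
zx and zy = v yz, and this gives the straightening rule x^{(a)} y^{(a+d)} = ∑_k v^{-k(k+d)}
y^{(k+d)} z^{(a-k)} x^{(k)} (`divPow_mul_divPow_of_qcomm`). The factors of ℰ_Ω are absorbed from
right to left. The invariant (`partialElt_eq_sum`) is that the part involving r_p for p < a is a sum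
of finished PBW factors at the vertices below a, preceded by a single pending power E_a^{(k_{a-1})}.
At a vertex outside Ω the pending power merges with the E_i^{(k_i)} released by straightening one
pair, which gives the binomial [k_{i-1}+k_i; k_i]. At a vertex of Ω the element C_i straightens two
pairs at once. The exponents that survive do not depend on u, so the sum over u is a scalar, and two
applications of the q-Vandermonde identity turn it into the sum over t_i (`omegaFactor_eq`).
Sparsity ensures that the vertex below i is not in Ω, so its factor is again one binomial. The
coefficient is thus a product of local factors (`zetaCoeff_eq_prod`). Independence. U⁺ acts on a
space with basis x^m, m an integer array (`rho`). E_i is a sum of column operators, each of which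
moves a box from row i+1 to row i or creates a diagonal box, twisted by the weight of the columns to
the right. This is a tensor product of one-column actions, so the Serre relations reduce to a single
column (`serreExpr_sum`). A PBW element sends x^0 to a nonzero multiple of the monomial with the
same exponents (`rho_pbw`), and distinct monomials are independent. -/

noncomputable section

namespace VarCom

/-! ### Quantum integers, binomials and the q-Vandermonde identity -/

theorem v_ne_zero : v ≠ 0 := RatFunc.X_ne_zero

theorem v_zpow_ne_zero (a : ℤ) : v ^ a ≠ 0 := zpow_ne_zero a v_ne_zero

theorem v_pow_ne_one {m : ℕ} (hm : m ≠ 0) : v ^ m ≠ 1 := by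
  intro hv
  have h1 : (algebraMap (Polynomial ℚ) (RatFunc ℚ)) (Polynomial.X ^ m) = algebraMap _ _ 1 := by
    rw [map_pow, RatFunc.algebraMap_X, map_one]; exact hv
  have h2 := RatFunc.algebraMap_injective ℚ h1
  have h3 := congrArg Polynomial.natDegree h2
  simp [hm] at h3

/-- The quantity `v^x - v^{-x}`. -/
def antisym (x : ℤ) : K := v ^ x - v ^ (-x)

theorem antisym_zero : antisym 0 = 0 := by simp [antisym]

theorem antisym_ne_zero {m : ℕ} (hm : m ≠ 0) : antisym m ≠ 0 := by
  intro h0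
  have h2 : v ^ (m : ℤ) * v ^ (m : ℤ) = v ^ (m : ℤ) * v ^ (-(m : ℤ)) := by
    rw [sub_eq_zero.1 h0]
  rw [← zpow_add₀ v_ne_zero, ← zpow_add₀ v_ne_zero, add_neg_cancel, zpow_zero] at h2
  refine v_pow_ne_one (m := m + m) (by omega) ?_
  exact_mod_cast h2

theorem antisym_add (x y : ℤ) :
    antisym (x + y) = v ^ (-x) * antisym y + v ^ y * antisym x := by
  have hx := v_zpow_ne_zero x
  have hy := v_zpow_ne_zero y
  simp only [antisym, neg_add, zpow_add₀ v_ne_zero, zpow_neg]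
  field_simp
  ring

/-- The quantum integer `[x]` for `x ∈ ℤ`. -/
def qint (x : ℤ) : K := antisym x / (v - v⁻¹)

theorem antisym_one : antisym 1 = v - v⁻¹ := by simp [antisym]

theorem v_sub_inv_ne_zero : v - v⁻¹ ≠ 0 := by
  rw [← antisym_one]; exact_mod_cast antisym_ne_zero one_ne_zero

theorem qint_zero : qint 0 = 0 := by simp [qint, antisym_zero]

theorem qint_one : qint 1 = 1 := by
  rw [qint, antisym_one, div_self v_sub_inv_ne_zero]

theorem qint_natCast (m : ℕ) : qint m = qnum m := rfl

theorem qint_add (x y : ℤ) : qint (x + y) = v ^ (-x) * qint y + v ^ y * qint x := by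
  simp only [qint, antisym_add]; ring

theorem qint_neg (x : ℤ) : qint (-x) = -qint x := by simp [qint, antisym]; ring

theorem qint_three_term (x : ℤ) : qint (x + 1) + qint (x - 1) = (v + v⁻¹) * qint x := by
  have h1 := qint_add x 1
  have h2 := qint_add x (-1)
  rw [qint_neg] at h2
  rw [sub_eq_add_neg, h1, h2, qint_one, zpow_neg_one, zpow_one]
  ring

theorem qnum_ne_zero {m : ℕ} (hm : m ≠ 0) : qnum m ≠ 0 :=
  div_ne_zero (antisym_ne_zero hm) v_sub_inv_ne_zero

theorem qfact_zero : qfact 0 = 1 := by simp [qfact]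

theorem qfact_succ (m : ℕ) : qfact (m + 1) = qfact m * qnum (m + 1) := by
  rw [qfact, qfact, Finset.prod_Icc_succ_top (by omega)]

theorem qfact_ne_zero (m : ℕ) : qfact m ≠ 0 :=
  Finset.prod_ne_zero_iff.2 fun i hi => qnum_ne_zero (by have := (Finset.mem_Icc.1 hi).1; omega)

theorem qbinom_zero (a : ℤ) : qbinom a 0 = 1 := by simp [qbinom]

theorem qbinom_succ_mul (a : ℤ) (m : ℕ) :
    qbinom a (m + 1) * antisym ((m + 1 : ℕ) : ℤ) = qbinom a m * antisym (a - m) := by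
  have h0 : antisym ((m + 1 : ℕ) : ℤ) ≠ 0 := antisym_ne_zero (by omega)
  have h1 : qbinom a (m + 1) = qbinom a m * (antisym (a - m) / antisym ((m + 1 : ℕ) : ℤ)) := by
    rw [qbinom, qbinom, Finset.prod_Icc_succ_top (by omega)]
    simp only [antisym]
    rw [show a + 1 - ((m + 1 : ℕ) : ℤ) = a - m by push_cast; ring,
      show -a - 1 + ((m + 1 : ℕ) : ℤ) = -(a - m) by push_cast; ring]
  rw [h1, mul_assoc, div_mul_cancel₀ _ h0]

theorem qbinom_eq_zero_of_lt {b m : ℕ} (hbm : b < m) : qbinom b m = 0 := by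
  refine Finset.prod_eq_zero (i := b + 1) (Finset.mem_Icc.2 ⟨by omega, by omega⟩) ?_
  push_cast
  simp

theorem qbinom_mul_qfact (a b : ℕ) :
    qbinom (a + b : ℤ) a * (qfact a * qfact b) = qfact (a + b) := by
  induction a generalizing b with
  | zero => simp [qbinom_zero, qfact_zero]
  | succ a ih =>
    have h := qbinom_succ_mul ((a + 1 : ℕ) + b : ℤ) a
    have h' : ((a + 1 : ℕ) + b : ℤ) - a = ((b + 1 : ℕ) : ℤ) := by push_cast; ring
    rw [h'] at h
    have hi := ih (b + 1)
    have e1 : ((a : ℤ) + ((b + 1 : ℕ) : ℤ)) = ((a + 1 : ℕ) + b : ℤ) := by push_cast; ring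
    rw [e1, show a + (b + 1) = a + 1 + b by ring] at hi
    rw [← hi, qfact_succ, qfact_succ, qnum, qnum]
    simp only [antisym] at h
    linear_combination (qfact a * qfact b / (v - v⁻¹)) * h

/-- Induction on m after clearing the factor `antisym (m + 1)`. It works for arbitrary integer upper
entries, in particular for -h. -/
theorem qbinom_vandermonde (x y : ℤ) (m : ℕ) :
    ∑ u ∈ Finset.range (m + 1), v ^ (-(x * m) + (x + y) * u) * qbinom x u * qbinom y (m - u)
      = qbinom (x + y) m := by
  induction m with
  | zero => simp [qbinom_zero]
  | succ m ih =>
    have h0 : antisym ((m + 1 : ℕ) : ℤ) ≠ 0 := antisym_ne_zero (by omega)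
    apply mul_right_cancel₀ h0
    rw [qbinom_succ_mul, ← ih, Finset.sum_mul, Finset.sum_mul]
    -- Write x + y - m = (x - u) + (y - (m - u)): by `antisym_add` one part raises the lower entry
    -- of the binomial in x, the other that of the binomial in y.
    have key : ∀ u ∈ Finset.range (m + 1),
        v ^ (-(x * m) + (x + y) * u) * qbinom x u * qbinom y (m - u) * antisym (x + y - m)
        = v ^ (-(x * (m + 1 : ℕ)) + (x + y) * u + u) * antisym (((m + 1 : ℕ) : ℤ) - u) *
            qbinom x u * qbinom y (m + 1 - u)
          + v ^ (-(x * (m + 1 : ℕ)) + (x + y) * ((u + 1 : ℕ) : ℤ) - (m + 1 : ℕ) + (u + 1 : ℕ)) *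
            antisym ((u + 1 : ℕ) : ℤ) * qbinom x (u + 1) * qbinom y (m + 1 - (u + 1)) := by
      intro u hu
      have hu' : u ≤ m := by simpa [Nat.lt_succ_iff] using hu
      obtain ⟨d, rfl⟩ := Nat.exists_eq_add_of_le hu'
      have e1 : u + d - u = d := by omega
      have e2 : u + d + 1 - u = d + 1 := by omega
      have e3 : u + d + 1 - (u + 1) = d := by omega
      rw [e1, e2, e3]
      have hx := qbinom_succ_mul x u
      have hy := qbinom_succ_mul y d
      have e4 : (x + y - ((u + d : ℕ) : ℤ)) = (x - u) + (y - d) := by push_cast; ring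
      have e5 : (((u + d + 1 : ℕ) : ℤ) - u) = ((d + 1 : ℕ) : ℤ) := by push_cast; ring
      rw [e4, e5, antisym_add]
      have p1 : v ^ (-(x * ((u + d + 1 : ℕ) : ℤ)) + (x + y) * u + u)
          = v ^ (-(x * ((u + d : ℕ) : ℤ)) + (x + y) * u) * v ^ (-(x - (u : ℤ))) := by
        rw [← zpow_add₀ v_ne_zero]; congr 1; push_cast; ring
      have p2 : v ^ (-(x * ((u + d + 1 : ℕ) : ℤ)) + (x + y) * ((u + 1 : ℕ) : ℤ)
            - ((u + d + 1 : ℕ) : ℤ) + ((u + 1 : ℕ) : ℤ))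
          = v ^ (-(x * ((u + d : ℕ) : ℤ)) + (x + y) * u) * v ^ (y - (d : ℤ)) := by
        rw [← zpow_add₀ v_ne_zero]; congr 1; push_cast; ring
      rw [p1, p2]
      generalize v ^ (-(x * ((u + d : ℕ) : ℤ)) + (x + y) * u) = P
      linear_combination (-(P * v ^ (-(x - (u : ℤ))) * qbinom x u)) * hy
        - (P * v ^ (y - (d : ℤ)) * qbinom y d) * hx
    rw [Finset.sum_congr rfl key, Finset.sum_add_distrib]
    -- Both sums extend to the full range of u because the added end term carries `antisym 0`. They
    -- then recombine through m + 1 = (m + 1 - u) + u.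
    have top : ∑ u ∈ Finset.range (m + 1),
        v ^ (-(x * (m + 1 : ℕ)) + (x + y) * u + u) * antisym (((m + 1 : ℕ) : ℤ) - u) *
            qbinom x u * qbinom y (m + 1 - u)
        = ∑ u ∈ Finset.range (m + 1 + 1),
        v ^ (-(x * (m + 1 : ℕ)) + (x + y) * u + u) * antisym (((m + 1 : ℕ) : ℤ) - u) *
            qbinom x u * qbinom y (m + 1 - u) := by
      rw [Finset.sum_range_succ _ (m + 1)]
      simp [antisym_zero]
    have bot : ∑ u ∈ Finset.range (m + 1),
        v ^ (-(x * (m + 1 : ℕ)) + (x + y) * ((u + 1 : ℕ) : ℤ) - (m + 1 : ℕ) + (u + 1 : ℕ)) *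
            antisym ((u + 1 : ℕ) : ℤ) * qbinom x (u + 1) * qbinom y (m + 1 - (u + 1))
        = ∑ u ∈ Finset.range (m + 1 + 1),
        v ^ (-(x * (m + 1 : ℕ)) + (x + y) * u - (m + 1 : ℕ) + u) *
            antisym (u : ℤ) * qbinom x u * qbinom y (m + 1 - u) := by
      rw [Finset.sum_range_succ' _ (m + 1)]
      simp [antisym_zero]
    rw [top, bot, ← Finset.sum_add_distrib]
    refine Finset.sum_congr rfl fun u _ => ?_
    have e : antisym ((m + 1 : ℕ) : ℤ) = v ^ (u : ℤ) * antisym (((m + 1 : ℕ) : ℤ) - u)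
        + v ^ (-((m + 1 : ℕ) : ℤ) + u) * antisym u := by
      have := antisym_add (((m + 1 : ℕ) : ℤ) - u) u
      rw [sub_add_cancel] at this
      rw [this, neg_sub, sub_eq_neg_add]; ring
    have p1 := zpow_add₀ v_ne_zero (-(x * ((m + 1 : ℕ) : ℤ)) + (x + y) * u) u
    have p2 := zpow_add₀ v_ne_zero (-(x * ((m + 1 : ℕ) : ℤ)) + (x + y) * u)
      (-((m + 1 : ℕ) : ℤ) + u)
    rw [← add_assoc, ← sub_eq_add_neg] at p2
    rw [e, p1, p2]
    ring

/-! ### The coefficient as a product of local factors -/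

/-- The local factor of the coefficient at a vertex of `Ω`. -/
def omegaFactor (h b a : ℕ) : K :=
  ∑ t ∈ Finset.range (min b a + 1),
    v ^ (-((b : ℤ) * a) - h * ((b : ℤ) + a) + (2 * (h : ℤ) + b + a) * t) *
      (qbinom a (a - t) * qbinom b t)

/-- Vandermonde for b + (h + a) expands the last binomial as a sum over s. After exchanging the
sums, Vandermonde for -h + (h + a) = a evaluates the sum over u, and s is left as the index t. -/
theorem omegaFactor_eq (h b a : ℕ) :
    ∑ u ∈ Finset.range (a + 1), qbinom (-(h : ℤ)) u * v ^ ((u : ℤ) * (a - b) - b * h) *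
      qbinom ((h : ℤ) + a + b) (a - u) = omegaFactor h b a := by
  -- The bound t ≤ b can be dropped, since [b; t] vanishes for t > b.
  have s1 : omegaFactor h b a = ∑ t ∈ Finset.range (a + 1),
    v ^ (-((b : ℤ) * a) - h * ((b : ℤ) + a) + (2 * (h : ℤ) + b + a) * t) *
      (qbinom a (a - t) * qbinom b t) := by
    refine Finset.sum_subset (fun t ht => ?_) fun t ht ht' => ?_
    · simp only [Finset.mem_range] at *; omega
    · simp only [Finset.mem_range] at *
      rw [qbinom_eq_zero_of_lt (b := b) (m := t) (by omega)]; simp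
  rw [s1]
  set f : ℕ → ℕ → K := fun u s => qbinom (-(h : ℤ)) u * v ^ ((u : ℤ) * (a - b) - b * h) *
    (v ^ (-(b * ((a : ℤ) - u)) + (b + (h + a : ℤ)) * s) * qbinom b s *
      qbinom (h + a : ℤ) (a - u - s)) with hf
  have lhs : ∀ u ∈ Finset.range (a + 1), qbinom (-(h : ℤ)) u * v ^ ((u : ℤ) * (a - b) - b * h) *
      qbinom ((h : ℤ) + a + b) (a - u) = ∑ s ∈ Finset.range (a + 1 - u), f u s := by
    intro u hu
    have hu' : u ≤ a := by simpa [Nat.lt_succ_iff] using hu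
    have hv := qbinom_vandermonde b (h + a : ℤ) (a - u)
    rw [show (h : ℤ) + a + b = b + (h + a : ℤ) by ring, ← hv, Finset.mul_sum,
      show a - u + 1 = a + 1 - u by omega]
    refine Finset.sum_congr rfl fun s _ => ?_
    simp only [hf]
    rw [Nat.cast_sub hu']
  have rhs : ∀ t ∈ Finset.range (a + 1),
      v ^ (-((b : ℤ) * a) - h * ((b : ℤ) + a) + (2 * (h : ℤ) + b + a) * t) *
      (qbinom a (a - t) * qbinom b t) = ∑ u ∈ Finset.range (a + 1 - t), f u t := by
    intro t ht
    have ht' : t ≤ a := by simpa [Nat.lt_succ_iff] using ht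
    have hv := qbinom_vandermonde (-(h : ℤ)) (h + a : ℤ) (a - t)
    rw [show -(h : ℤ) + (h + a) = a by ring] at hv
    rw [← hv, Finset.sum_mul, Finset.mul_sum, show a - t + 1 = a + 1 - t by omega]
    refine Finset.sum_congr rfl fun u _ => ?_
    simp only [hf]
    rw [show a - u - t = a - t - u by omega, Nat.cast_sub ht']
    have : v ^ (-((b : ℤ) * a) - h * ((b : ℤ) + a) + (2 * (h : ℤ) + b + a) * t) *
        v ^ (-(-(h : ℤ) * ((a : ℤ) - t)) + a * u) =
        v ^ ((u : ℤ) * (a - b) - b * h) *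
          v ^ (-(b * ((a : ℤ) - u)) + (b + (h + a : ℤ)) * t) := by
      rw [← zpow_add₀ v_ne_zero, ← zpow_add₀ v_ne_zero]; congr 1; ring
    linear_combination (qbinom (-(h : ℤ)) u * qbinom (h + a : ℤ) (a - t - u) * qbinom b t) * this
  rw [Finset.sum_congr rfl lhs, Finset.sum_congr rfl rhs]
  refine Finset.sum_comm' fun u t => ?_
  simp only [Finset.mem_range]; omega

theorem v_zpow_sum {ι : Type*} (s : Finset ι) (f : ι → ℤ) :
    v ^ (∑ i ∈ s, f i) = ∏ i ∈ s, v ^ f i := by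
  classical
  induction s using Finset.induction_on with
  | empty => simp
  | insert a s ha ih => rw [Finset.sum_insert ha, Finset.prod_insert ha, zpow_add₀ v_ne_zero, ih]

/-- The local factor of the coefficient at the vertex `i`. -/
def vertexFactor (h k : ℕ → ℕ) (i : ℕ) : K :=
  v ^ (-((k i : ℤ) ^ 2)) *
    if h i = 0 then qbinom ((k (i - 1) : ℤ) + k i) (k i) else omegaFactor (h i) (k (i - 1)) (k i)

theorem zetaCoeff_eq_prod (n : ℕ) (h k : ℕ → ℕ) :
    zetaCoeff n h k = ∏ i ∈ Finset.Icc 1 n, vertexFactor h k i := by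
  have hsub : Omega n h ⊆ Finset.Icc 1 n := Finset.filter_subset _ _
  simp only [vertexFactor]
  rw [Finset.prod_mul_distrib, ← v_zpow_sum, ← Finset.prod_sdiff hsub, mul_comm (∏ i ∈ _ \ _, _)]
  have h1 : ∏ i ∈ Finset.Icc 1 n \ Omega n h,
      (if h i = 0 then qbinom ((k (i - 1) : ℤ) + k i) (k i)
        else omegaFactor (h i) (k (i - 1)) (k i))
      = ∏ i ∈ Finset.Icc 1 n \ Omega n h, qbinom ((k (i - 1) : ℤ) + k i) (k i) := by
    refine Finset.prod_congr rfl fun i hi => if_pos ?_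
    simp only [Omega, Finset.mem_sdiff, Finset.mem_filter, not_and, not_not] at hi
    exact hi.2 hi.1
  have h2 : ∏ i ∈ Omega n h,
      (if h i = 0 then qbinom ((k (i - 1) : ℤ) + k i) (k i)
        else omegaFactor (h i) (k (i - 1)) (k i))
      = ∏ i : {i // i ∈ Omega n h}, omegaFactor (h i.1) (k (i.1 - 1)) (k i.1) := by
    rw [← Finset.prod_coe_sort]
    refine Finset.prod_congr rfl fun i _ => if_neg ?_
    exact (Finset.mem_filter.1 i.2).2
  rw [h1, h2]
  simp only [omegaFactor]
  -- Distributivity: the product over Ω of sums over t_i is the sum over families (t_i).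
  rw [Finset.prod_univ_sum, Finset.sum_mul, Finset.mul_sum, zetaCoeff]
  refine Finset.sum_congr rfl fun t _ => ?_
  rw [Finset.prod_mul_distrib (f := fun i : {i // i ∈ Omega n h} => v ^ (_ : ℤ)), ← v_zpow_sum,
    ← mul_assoc, ← mul_assoc, ← zpow_add₀ v_ne_zero]
  congr 3
  rw [← Finset.sum_coe_sort (Omega n h), ← Finset.sum_coe_sort (Omega n h),
    Finset.sum_add_distrib, Finset.sum_sub_distrib, Finset.sum_neg_distrib,
    Finset.sum_neg_distrib]
  ring

/-! ### Straightening divided powers in rank two -/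

section GeneralField

variable {F R : Type*} [Field F] [Ring R] [Algebra F R]

/-- With z = xy - q⁻¹yx, the defect xz - qzx is the Serre expression, so the Serre relation is
equivalent to q-commutation of x with z. -/
theorem mul_qcommutator_sub (q : F) (hq : q ≠ 0) (x y : R) :
    x * (x * y - q⁻¹ • (y * x)) - q • ((x * y - q⁻¹ • (y * x)) * x) =
      x ^ 2 * y - (q + q⁻¹) • (x * y * x) + y * x ^ 2 := by
  simp only [pow_two, mul_sub, sub_mul, mul_smul_comm, smul_mul_assoc, smul_sub, smul_smul,
    mul_assoc, mul_inv_cancel₀ hq]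
  module

theorem qcommutator_mul_sub (q : F) (hq : q ≠ 0) (x y : R) :
    (x * y - q⁻¹ • (y * x)) * y - q • (y * (x * y - q⁻¹ • (y * x))) =
      y ^ 2 * x - (q + q⁻¹) • (y * x * y) + x * y ^ 2 := by
  simp only [pow_two, mul_sub, sub_mul, mul_smul_comm, smul_mul_assoc, smul_sub, smul_smul,
    mul_assoc, mul_inv_cancel₀ hq]
  module

/-- The linear algebra in the induction step of `mul_divPow_of_qcomm`, where e = [b+2], p =
v^{-(b+1)}, q = v and c = [b+1]. -/
theorem smul_recombine {q p c e : F} (he : e = p + q * c) (A B : R) :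
    p • (A + q⁻¹ • e • B) + q • c • A = e • (p * q⁻¹) • B + e • A := by
  subst he
  module

end GeneralField

section DividedPowers

variable {n : ℕ}

theorem mul_divPow (x : Uplus n) (m : ℕ) :
    x * divPow x m = qnum (m + 1) • divPow x (m + 1) := by
  rw [divPow, divPow, mul_smul_comm, ← pow_succ', smul_smul, qfact_succ, mul_inv, mul_comm,
    mul_assoc, inv_mul_cancel₀ (qnum_ne_zero (by omega)), mul_one]

theorem divPow_mul_self (x : Uplus n) (m : ℕ) :
    divPow x m * x = qnum (m + 1) • divPow x (m + 1) := by
  rw [← mul_divPow, divPow, mul_smul_comm, smul_mul_assoc, ← pow_succ', ← pow_succ]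

theorem divPow_one (x : Uplus n) : divPow x 1 = x := by
  have h := mul_divPow x 0
  rw [divPow_zero, mul_one, ← qint_natCast] at h
  simpa [qint_one] using h.symm

theorem divPow_mul_divPow (x : Uplus n) (a b : ℕ) :
    divPow x a * divPow x b = qbinom (a + b : ℤ) a • divPow x (a + b) := by
  have h := qbinom_mul_qfact a b
  have ha := qfact_ne_zero a
  have hb := qfact_ne_zero b
  have hab := qfact_ne_zero (a + b)
  simp only [divPow, smul_mul_smul_comm, ← pow_add, smul_smul]
  congr 1
  field_simp
  rw [← h]; ring

theorem mul_divPow_of_mul_eq_smul {x z : Uplus n} (hxz : x * z = v • (z * x)) (m : ℕ) :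
    x * divPow z m = v ^ (m : ℤ) • (divPow z m * x) := by
  have h : x * z ^ m = v ^ m • (z ^ m * x) := by
    induction m with
    | zero => simp
    | succ m ih =>
      rw [pow_succ, ← mul_assoc, ih, smul_mul_assoc, mul_assoc, hxz, mul_smul_comm, smul_smul,
        ← pow_succ, mul_assoc]
  rw [divPow, mul_smul_comm, h, smul_mul_assoc, smul_comm, zpow_natCast]

theorem mul_divPow_of_qcomm {x y z : Uplus n} (hxy : x * y = z + v⁻¹ • (y * x))
    (hzy : z * y = v • (y * z)) (b : ℕ) :
    x * divPow y (b + 1) = v ^ (-((b + 1 : ℕ) : ℤ)) • (divPow y (b + 1) * x) + divPow y b * z := by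
  induction b with
  | zero => simp [divPow_one, divPow_zero, hxy, add_comm]
  | succ b ih =>
    have h0 : qnum (b + 1 + 1) ≠ 0 := qnum_ne_zero (by omega)
    have key : qnum (b + 1 + 1) • (x * divPow y (b + 1 + 1)) =
        qnum (b + 1 + 1) • (v ^ (-((b + 1 + 1 : ℕ) : ℤ)) • (divPow y (b + 1 + 1) * x)
          + divPow y (b + 1) * z) := by
      rw [← mul_smul_comm, ← divPow_mul_self, ← mul_assoc, ih, add_mul, smul_mul_assoc, mul_assoc,
        hxy, mul_assoc, hzy, mul_smul_comm, ← mul_assoc, divPow_mul_self, mul_add, mul_smul_comm,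
        ← mul_assoc, divPow_mul_self]
      simp only [smul_mul_assoc]
      have e : qnum (b + 1 + 1) = v ^ (-((b + 1 : ℕ) : ℤ)) + v * qnum (b + 1) := by
        have := qint_add ((b + 1 : ℕ) : ℤ) 1
        rw [qint_one, zpow_one, mul_one] at this
        exact_mod_cast this
      have e2 : v ^ (-((b + 1 + 1 : ℕ) : ℤ)) = v ^ (-((b + 1 : ℕ) : ℤ)) * v⁻¹ := by
        rw [← zpow_neg_one, ← zpow_add₀ v_ne_zero]; congr 1
      rw [e2, smul_add (qnum (b + 1 + 1)) _ (divPow y (b + 1) * z)]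
      exact smul_recombine e _ _
    exact smul_right_injective _ h0 key

/-- Induction on a, with d general because the step uses the formula at d + 1. After multiplication
by [a+1], a single x is moved through y^{(k+d+1)} z^{(a-k)}. It either reaches x^{(k)} or is
absorbed with one y into a z. -/
theorem divPow_mul_divPow_of_qcomm {x y z : Uplus n} (hxy : x * y = z + v⁻¹ • (y * x))
    (hxz : x * z = v • (z * x)) (hzy : z * y = v • (y * z)) (a d : ℕ) :
    divPow x a * divPow y (a + d) = ∑ k ∈ Finset.range (a + 1),
      v ^ (-((k : ℤ) * (k + d))) • (divPow y (k + d) * divPow z (a - k) * divPow x k) := by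
  induction a generalizing d with
  | zero => simp [divPow_zero]
  | succ a ih =>
    have h0 : qnum (a + 1) ≠ 0 := qnum_ne_zero (by omega)
    refine smul_right_injective _ h0 ?_
    simp only
    rw [← smul_mul_assoc, ← mul_divPow, mul_assoc, show a + 1 + d = a + (d + 1) by ring, ih,
      Finset.mul_sum, Finset.smul_sum]
    have key : ∀ k ∈ Finset.range (a + 1),
        x * v ^ (-((k : ℤ) * (k + (d + 1 : ℕ)))) •
          (divPow y (k + (d + 1)) * divPow z (a - k) * divPow x k) =
        (v ^ (-(((k + 1 : ℕ) : ℤ) * ((k + 1 : ℕ) + d)))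
            * (v ^ ((a : ℤ) + 1 - ((k + 1 : ℕ) : ℤ)) * qint ((k + 1 : ℕ) : ℤ))) •
          (divPow y (k + 1 + d) * divPow z (a + 1 - (k + 1)) * divPow x (k + 1)) +
        (v ^ (-((k : ℤ) * (k + d))) * (v ^ (-(k : ℤ)) * qint ((a : ℤ) + 1 - k))) •
          (divPow y (k + d) * divPow z (a + 1 - k) * divPow x k) := by
      intro k hk
      obtain ⟨e, rfl⟩ := Nat.exists_eq_add_of_le (show k ≤ a by simpa [Nat.lt_succ_iff] using hk)
      have e1 : k + e - k = e := by omega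
      have e2 : k + e + 1 - (k + 1) = e := by omega
      have e3 : k + e + 1 - k = e + 1 := by omega
      have e4 : ((k + e : ℕ) : ℤ) + 1 - k = ((e + 1 : ℕ) : ℤ) := by push_cast; ring
      have e5 : ((k + e : ℕ) : ℤ) + 1 - ((k + 1 : ℕ) : ℤ) = (e : ℤ) := by push_cast; ring
      rw [e1, e2, e3, e4, e5, qint_natCast, qint_natCast, mul_smul_comm, ← mul_assoc, ← mul_assoc,
        ← add_assoc k d 1, mul_divPow_of_qcomm hxy hzy, add_mul, add_mul, smul_mul_assoc,
        mul_assoc (divPow y (k + d + 1)) x, mul_divPow_of_mul_eq_smul hxz, mul_assoc _ z,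
        mul_divPow, mul_smul_comm, smul_mul_assoc, ← mul_assoc, smul_mul_assoc,
        mul_assoc _ x, mul_divPow, show k + 1 + d = k + d + 1 by ring]
      simp only [mul_smul_comm, smul_mul_assoc, smul_add, smul_smul]
      congr 2
      · rw [← mul_assoc, ← mul_assoc, ← zpow_add₀ v_ne_zero, ← mul_assoc, ← zpow_add₀ v_ne_zero]
        rw [← zpow_add₀ v_ne_zero]; congr 2; push_cast; ring
      · rw [← mul_assoc, ← zpow_add₀ v_ne_zero]
        congr 2; push_cast; ring
    rw [Finset.sum_congr rfl key, Finset.sum_add_distrib]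
    have s1 : ∑ k ∈ Finset.range (a + 1),
        (v ^ (-(((k + 1 : ℕ) : ℤ) * ((k + 1 : ℕ) + d)))
            * (v ^ ((a : ℤ) + 1 - ((k + 1 : ℕ) : ℤ)) * qint ((k + 1 : ℕ) : ℤ))) •
          (divPow y (k + 1 + d) * divPow z (a + 1 - (k + 1)) * divPow x (k + 1)) =
        ∑ k ∈ Finset.range (a + 1 + 1),
        (v ^ (-((k : ℤ) * (k + d))) * (v ^ ((a : ℤ) + 1 - k) * qint k)) •
          (divPow y (k + d) * divPow z (a + 1 - k) * divPow x k) := by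
      rw [Finset.sum_range_succ' _ (a + 1)]
      simp [qint_zero]
    have s2 : ∑ k ∈ Finset.range (a + 1),
        (v ^ (-((k : ℤ) * (k + d))) * (v ^ (-(k : ℤ)) * qint ((a : ℤ) + 1 - k))) •
          (divPow y (k + d) * divPow z (a + 1 - k) * divPow x k) =
        ∑ k ∈ Finset.range (a + 1 + 1),
        (v ^ (-((k : ℤ) * (k + d))) * (v ^ (-(k : ℤ)) * qint ((a : ℤ) + 1 - k))) •
          (divPow y (k + d) * divPow z (a + 1 - k) * divPow x k) := by
      rw [Finset.sum_range_succ _ (a + 1)]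
      simp [qint_zero]
    rw [s1, s2, ← Finset.sum_add_distrib]
    refine Finset.sum_congr rfl fun k _ => ?_
    rw [← add_smul, ← mul_add, smul_smul, mul_comm (qnum _)]
    congr 2
    -- The two contributions to the k-th term add up by [a+1] = v^{-k}[a+1-k] + v^{a+1-k}[k].
    have := qint_add k ((a : ℤ) + 1 - k)
    rw [add_sub_cancel] at this
    rw [← qint_natCast, show ((a + 1 : ℕ) : ℤ) = (a : ℤ) + 1 by push_cast; rfl, this, add_comm]

end DividedPowers

/-! ### Straightening inside `Uplus n`, and the elements C_i -/

section Relations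

variable {n : ℕ}

theorem serre_E {i j : ℕ} (hi : 1 ≤ i ∧ i ≤ n) (hj : 1 ≤ j ∧ j ≤ n)
    (hij : i + 1 = j ∨ j + 1 = i) :
    E n i ^ 2 * E n j - (v + v⁻¹) • (E n i * E n j * E n i) + E n j * E n i ^ 2 = 0 := by
  have h := RingQuot.mkAlgHom_rel K (SerreRel.serre (n := n) ⟨i, hi⟩ ⟨j, hj⟩ hij)
  simpa only [E, dif_pos hi, dif_pos hj, map_add, map_sub, map_mul, map_pow, map_smul, map_zero]
    using h

theorem Eroot_succ (i : ℕ) :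
    Eroot n i (i + 1) = E n i * E n (i + 1) - v⁻¹ • (E n (i + 1) * E n i) := by
  simp [Eroot, rootElt]

theorem E_mul_E_succ (i : ℕ) :
    E n i * E n (i + 1) = Eroot n i (i + 1) + v⁻¹ • (E n (i + 1) * E n i) := by
  rw [Eroot_succ]; abel

theorem E_mul_Eroot_succ {i : ℕ} (h1 : 1 ≤ i) (h2 : i + 1 ≤ n) :
    E n i * Eroot n i (i + 1) = v • (Eroot n i (i + 1) * E n i) := by
  have h := serre_E (n := n) (i := i) (j := i + 1) ⟨h1, by omega⟩ ⟨by omega, h2⟩ (Or.inl rfl)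
  rw [← sub_eq_zero, ← h, Eroot_succ]
  exact mul_qcommutator_sub v v_ne_zero _ _

theorem Eroot_succ_mul_E {i : ℕ} (h1 : 1 ≤ i) (h2 : i + 1 ≤ n) :
    Eroot n i (i + 1) * E n (i + 1) = v • (E n (i + 1) * Eroot n i (i + 1)) := by
  have h := serre_E (n := n) (i := i + 1) (j := i) ⟨by omega, h2⟩ ⟨h1, by omega⟩ (Or.inr rfl)
  rw [← sub_eq_zero, ← h, Eroot_succ]
  exact qcommutator_mul_sub v v_ne_zero _ _

/-- The alternative a = 0 covers the boundary, where E_0 = E_{n+1} = 1 satisfies no q-commutation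
but r_0 = r_n = 0. -/
theorem divPow_E_mul_divPow_E_succ {i a d : ℕ} (h : (1 ≤ i ∧ i + 1 ≤ n) ∨ a = 0) :
    divPow (E n i) a * divPow (E n (i + 1)) (a + d) = ∑ k ∈ Finset.range (a + 1),
      v ^ (-((k : ℤ) * (k + d))) •
        (divPow (E n (i + 1)) (k + d) * divPow (Eroot n i (i + 1)) (a - k) * divPow (E n i) k) := by
  rcases h with ⟨h1, h2⟩ | rfl
  · exact divPow_mul_divPow_of_qcomm (E_mul_E_succ i) (E_mul_Eroot_succ h1 h2)
      (Eroot_succ_mul_E h1 h2) a d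
  · simp [divPow_zero]

/-- The product `E_i^{(r_i)} E_{i+1}^{(r_i)}`. -/
def pairElt (n : ℕ) (r : ℕ → ℕ) (i : ℕ) : Uplus n :=
  divPow (E n i) (r i) * divPow (E n (i + 1)) (r i)

theorem pairElt_mul_divPow {r : ℕ → ℕ} {i : ℕ} (b : ℕ) (h : (1 ≤ i ∧ i + 1 ≤ n) ∨ r i = 0) :
    pairElt n r i * divPow (E n i) b = ∑ k ∈ Finset.range (r i + 1),
      (v ^ (-((k : ℤ) ^ 2)) * qbinom (b + k : ℤ) k) •
        (divPow (E n (i + 1)) k *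
          (divPow (Eroot n i (i + 1)) (r i - k) * divPow (E n i) (b + k))) := by
  have h1 := divPow_E_mul_divPow_E_succ (n := n) (d := 0) h
  rw [add_zero] at h1
  rw [pairElt, h1, Finset.sum_mul]
  refine Finset.sum_congr rfl fun k _ => ?_
  rw [smul_mul_assoc, mul_assoc, divPow_mul_divPow, mul_smul_comm, smul_smul, add_zero, mul_assoc,
    add_comm k b, add_comm (k : ℤ) b]
  congr 3
  push_cast; ring

/-- Both pairs in each term of C_{i+1} are straightened and the adjacent powers of E_{i+1} merge.
The factor v^{-b²} belongs to vertex i and is kept apart from the local factor of vertex i + 1. -/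
theorem Celt_succ {r h : ℕ → ℕ} {i : ℕ} (h0 : (1 ≤ i ∧ i + 1 ≤ n) ∨ r i = 0)
    (h1 : i + 2 ≤ n ∨ r (i + 1) = 0) :
    Celt n r h (i + 1) = ∑ b ∈ Finset.range (r i + 1), ∑ k ∈ Finset.range (r (i + 1) + 1),
      (v ^ (-((k : ℤ) ^ 2)) * omegaFactor (h (i + 1)) b k * v ^ (-((b : ℤ) ^ 2))) •
        (divPow (E n (i + 2)) k * ((divPow (Eroot n (i + 1) (i + 2)) (r (i + 1) - k) *
          divPow (E n (i + 1)) (h (i + 1) + b + k)) *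
          (divPow (Eroot n i (i + 1)) (r i - b) * divPow (E n i) b))) := by
  set R := r (i + 1)
  set H := h (i + 1)
  set f : ℕ → ℕ → ℕ → Uplus n := fun u k b =>
    (qbinom (-(H : ℤ)) u * v ^ (-(((k : ℤ) - u) * k)) * v ^ (-((b : ℤ) * (b + (H + u : ℕ)))) *
      qbinom ((H : ℤ) + k + b) (k - u)) •
        (divPow (E n (i + 2)) k * ((divPow (Eroot n (i + 1) (i + 2)) (R - k) *
          divPow (E n (i + 1)) (H + b + k)) *
          (divPow (Eroot n i (i + 1)) (r i - b) * divPow (E n i) b))) with hf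
  -- With the exponent k + u of E_{i+2} as the new index, the monomial no longer depends on u.
  have e1 : ∀ u ∈ Finset.range (R + 1), qbinom (-(H : ℤ)) u •
      (divPow (E n (i + 1)) (R - u) * divPow (E n (i + 1 + 1)) R *
        divPow (E n (i + 1 - 1)) (r (i + 1 - 1)) * divPow (E n (i + 1)) (H + r (i + 1 - 1) + u))
      = ∑ k ∈ Finset.range (R + 1 - u), ∑ b ∈ Finset.range (r i + 1), f u (k + u) b := by
    intro u hu
    have hu' : u ≤ R := by simpa [Nat.lt_succ_iff] using hu
    have a1 := divPow_E_mul_divPow_E_succ (n := n) (i := i + 1) (a := R - u) (d := u) (by omega)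
    have a2 := divPow_E_mul_divPow_E_succ (n := n) (i := i) (a := r i) (d := H + u) h0
    rw [show R - u + u = R by omega, show R - u + 1 = R + 1 - u by omega] at a1
    rw [Nat.add_sub_cancel, show H + r i + u = r i + (H + u) by ring, mul_assoc, a1, a2,
      Finset.sum_mul_sum, Finset.smul_sum]
    refine Finset.sum_congr rfl fun k hk => ?_
    rw [Finset.smul_sum]
    refine Finset.sum_congr rfl fun b hb => ?_
    have m1 := divPow_mul_divPow (E n (i + 1)) k (b + (H + u))
    have c1 : ∀ A B C D F G : Uplus n, A * B * C * (D * F * G) = A * (B * (C * D) * (F * G)) := by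
      intros; simp only [mul_assoc]
    rw [smul_mul_smul_comm, c1, m1]
    simp only [hf, mul_smul_comm, smul_mul_assoc, smul_smul]
    rw [show R - (k + u) = R - u - k by omega, show k + u - u = k by omega,
      show k + (b + (H + u)) = H + b + (k + u) by ring]
    congr 1
    push_cast
    rw [show (k : ℤ) + u - u = k by ring,
      show (k : ℤ) + (b + (H + u)) = H + (k + u) + b by ring]
    ring
  rw [Celt, Finset.sum_congr rfl e1]
  have e2 : ∑ u ∈ Finset.range (R + 1), ∑ k ∈ Finset.range (R + 1 - u),
      ∑ b ∈ Finset.range (r i + 1), f u (k + u) b =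
      ∑ k ∈ Finset.range (R + 1), ∑ u ∈ Finset.range (k + 1),
      ∑ b ∈ Finset.range (r i + 1), f u k b := by
    rw [← Finset.sum_range_diag_flip (R + 1) fun u k => ∑ b ∈ Finset.range (r i + 1), f u (k + u) b]
    refine Finset.sum_congr rfl fun k _ => Finset.sum_congr rfl fun u hu => ?_
    rw [Nat.sub_add_cancel (by simpa [Nat.lt_succ_iff] using hu)]
  rw [e2]
  conv_rhs => rw [Finset.sum_comm]
  refine Finset.sum_congr rfl fun k _ => ?_
  rw [Finset.sum_comm]
  refine Finset.sum_congr rfl fun b _ => ?_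
  simp only [hf]
  rw [← Finset.sum_smul, ← omegaFactor_eq, Finset.mul_sum, Finset.sum_mul]
  congr 1
  refine Finset.sum_congr rfl fun u _ => ?_
  have e3 : v ^ (-(((k : ℤ) - u) * k)) * v ^ (-((b : ℤ) * (b + (H + u : ℕ)))) =
      v ^ (-((k : ℤ) ^ 2)) * v ^ ((u : ℤ) * (k - b) - b * H) * v ^ (-((b : ℤ) ^ 2)) := by
    simp only [← zpow_add₀ v_ne_zero]; congr 1; push_cast; ring
  linear_combination (qbinom (-(H : ℤ)) u * qbinom ((H : ℤ) + k + b) (k - u)) * e3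

end Relations

/-! ### Absorbing the factors of ℰ_Ω vertex by vertex -/

section Expansion

variable {n : ℕ} {r h : ℕ → ℕ}

/-- The product of the factors of `ℰ_Ω(r,h)` that involve `r_p` for `p < a`; meaningful if
`a ∉ Ω`. -/
def partialElt (n : ℕ) (r h : ℕ → ℕ) : ℕ → Uplus n
  | 0 => 1
  | 1 => 1
  | a + 2 =>
    if a + 1 ∈ Omega n h then Celt n r h (a + 1) * partialElt n r h a
    else pairElt n r (a + 1) * partialElt n r h (a + 1)

theorem mem_Omega {i : ℕ} : i ∈ Omega n h ↔ (1 ≤ i ∧ i ≤ n) ∧ h i ≠ 0 := by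
  simp [Omega]

theorem Belt_of_le {i j : ℕ} (hij : j ≤ i) : Belt n r i j = 1 := by
  simp [Belt, Nat.sub_eq_zero_of_le hij]

theorem Belt_of_lt {i j : ℕ} (hij : i < j) :
    Belt n r i j = Belt n r (i + 1) j * pairElt n r i := by
  rw [Belt, Belt, show j - i = (j - (i + 1)) + 1 by omega, List.range'_succ, List.reverse_cons,
    List.map_append, List.prod_append]
  simp [pairElt]

theorem EOmegaAux_succ {l : List ℕ} {a : ℕ} (ha : a < n) (hl : ∀ i ∈ l, a + 1 < i) :
    EOmegaAux n r h l a = EOmegaAux n r h l (a + 1) * pairElt n r a := by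
  cases l with
  | nil => exact Belt_of_lt ha
  | cons i l =>
    have hi := hl i (by simp)
    rw [EOmegaAux, EOmegaAux, Belt_of_lt (show a < i - 1 by omega), ← mul_assoc]

theorem pairElt_of_eq_zero {i : ℕ} (hi : r i = 0) : pairElt n r i = 1 := by
  simp [pairElt, hi, divPow_zero]

/-- The product is independent of the cut a. The cut moves up past one vertex outside Ω, or past a
together with a + 1 when a + 1 ∈ Ω; sparsity makes the new cut admissible. Only the cut a = 1 may
lie in Ω. -/
theorem EOmegaAux_mul_partialElt (hrn : r n = 0)
    (hsparse : ∀ i, 1 ≤ i → i + 1 ≤ n → i ∉ Omega n h ∨ i + 1 ∉ Omega n h) (d : ℕ) :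
    ∀ a, 1 ≤ a → a + d = n + 1 → (a = 1 ∨ a ∉ Omega n h) →
      EOmegaAux n r h ((List.range' a d).filter fun i => h i ≠ 0) a * partialElt n r h a =
        partialElt n r h (n + 1) := by
  induction d using Nat.strong_induction_on with
  | _ d ih =>
    intro a ha1 had ha
    rcases d with _ | d
    · obtain rfl : a = n + 1 := by omega
      simp [EOmegaAux, Belt_of_le]
    obtain ⟨b, rfl⟩ : ∃ b, a = b + 1 := ⟨a - 1, by omega⟩
    by_cases hO : b + 1 ∈ Omega n h
    · obtain rfl : b = 0 := by
        rcases ha with ha | ha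
        · omega
        · exact absurd hO ha
      have hh := (mem_Omega.1 hO).2
      rw [zero_add] at *
      have e := ih d (by omega) 2 (by omega) (by omega) <| Or.inr <| by
        by_cases h2 : 2 ≤ n
        · exact (hsparse 1 le_rfl h2).resolve_left (not_not.2 hO)
        · exact fun h3 => h2 (mem_Omega.1 h3).1.2
      rw [List.range'_succ, List.filter_cons_of_pos (by simpa using hh), EOmegaAux,
        Belt_of_le (by omega), ← e, partialElt, partialElt, if_pos (by simpa using hO), partialElt]
      simp
    have hb : h (b + 1) = 0 := by
      by_contra h0
      exact hO (mem_Omega.2 ⟨by omega, h0⟩)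
    rw [List.range'_succ, List.filter_cons_of_neg (by simpa using hb)]
    have step : partialElt n r h (b + 2) = pairElt n r (b + 1) * partialElt n r h (b + 1) := by
      rw [partialElt, if_neg hO]
    rcases d with _ | d
    · obtain rfl : n = b + 1 := by omega
      rw [step, pairElt_of_eq_zero hrn]
      simp [EOmegaAux, Belt_of_le]
    by_cases hO2 : b + 2 ∈ Omega n h
    · have e := ih d (by omega) (b + 3) (by omega) (by omega) <| Or.inr <| by
        by_cases h2 : b + 3 ≤ n
        · exact (hsparse (b + 2) (by omega) h2).resolve_left (not_not.2 hO2)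
        · exact fun h3 => h2 (mem_Omega.1 h3).1.2
      rw [List.range'_succ, List.filter_cons_of_pos (by simpa using (mem_Omega.1 hO2).2),
        EOmegaAux, Belt_of_le (by omega), mul_one, ← e, partialElt, if_pos hO2, mul_assoc]
    · have hb2 : h (b + 2) = 0 := by
        by_contra h0
        exact hO2 (mem_Omega.2 ⟨by omega, h0⟩)
      have e := ih (d + 1) (by omega) (b + 2) (by omega) (by omega) (Or.inr hO2)
      rw [EOmegaAux_succ (by omega), mul_assoc, ← step, e]
      intro i hi
      rw [List.mem_filter, List.mem_range'_1] at hi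
      have : i ≠ b + 2 := by
        rintro rfl
        simp [hb2] at hi
      omega

theorem EOmega_eq_partialElt (hrn : r n = 0)
    (hsparse : ∀ i, 1 ≤ i → i + 1 ≤ n → i ∉ Omega n h ∨ i + 1 ∉ Omega n h) :
    EOmega n r h = partialElt n r h (n + 1) := by
  have := EOmegaAux_mul_partialElt hrn hsparse n 1 le_rfl (by omega) (Or.inl rfl)
  rwa [partialElt, mul_one] at this

open scoped Classical in
/-- The sequences `k` with `k i ≤ r i` for `i < a` and `k i = 0` for `i ≥ a`. -/
def seqBox (r : ℕ → ℕ) : ℕ → Finset (ℕ → ℕ)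
  | 0 => {0}
  | a + 1 => (seqBox r a ×ˢ Finset.range (r a + 1)).image fun p => Function.update p.1 a p.2

theorem mem_seqBox {a : ℕ} {k : ℕ → ℕ} :
    k ∈ seqBox r a ↔ (∀ i < a, k i ≤ r i) ∧ ∀ i, a ≤ i → k i = 0 := by
  induction a generalizing k with
  | zero => simp [seqBox, funext_iff]
  | succ a ih =>
    simp only [seqBox, Finset.mem_image, Finset.mem_product, Finset.mem_range, Prod.exists, ih]
    constructor
    · rintro ⟨k', j, ⟨⟨h1, h2⟩, h3⟩, rfl⟩
      refine ⟨fun i hi => ?_, fun i hi => ?_⟩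
      · by_cases hia : i = a
        · subst hia; simp; omega
        · rw [Function.update_of_ne hia]; exact h1 i (by omega)
      · rw [Function.update_of_ne (by omega)]; exact h2 i (by omega)
    · rintro ⟨h1, h2⟩
      refine ⟨Function.update k a 0, k a, ⟨⟨fun i hi => ?_, fun i hi => ?_⟩, ?_⟩, by simp⟩
      · rw [Function.update_of_ne (by omega)]; exact h1 i (by omega)
      · by_cases hia : i = a
        · subst hia; simp
        · rw [Function.update_of_ne hia]; exact h2 i (by omega)
      · exact Nat.lt_succ_of_le (h1 a (by omega))

open scoped Classical in
theorem sum_seqBox_succ {M : Type*} [AddCommMonoid M] (a : ℕ) (f : (ℕ → ℕ) → M) :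
    ∑ k ∈ seqBox r (a + 1), f k =
      ∑ k ∈ seqBox r a, ∑ j ∈ Finset.range (r a + 1), f (Function.update k a j) := by
  rw [seqBox, Finset.sum_image, Finset.sum_product]
  rintro ⟨k, j⟩ hk ⟨k', j'⟩ hk' he
  simp only [Finset.coe_product, Set.mem_prod, Finset.mem_coe, mem_seqBox] at hk hk'
  simp only at he
  have hj : j = j' := by simpa using congrFun he a
  refine Prod.ext (funext fun i => ?_) hj
  by_cases hia : i = a
  · subst hia
    simp [hk.1.2 i le_rfl, hk'.1.2 i le_rfl]
  · simpa [hia] using congrFun he i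

/-- The part of `ζ_k E(r-k, h ∔ k)` that involves the vertices `1, …, a - 1`. -/
def expTerm (n : ℕ) (r h k : ℕ → ℕ) : ℕ → Uplus n
  | 0 => 1
  | 1 => 1
  | a + 2 => vertexFactor h k (a + 1) • (divPow (Eroot n (a + 1) (a + 2)) (r (a + 1) - k (a + 1)) *
      divPow (E n (a + 1)) (h (a + 1) + k a + k (a + 1))) * expTerm n r h k (a + 1)

theorem expTerm_congr {k k' : ℕ → ℕ} {a : ℕ} (hk : ∀ i < a, k i = k' i) :
    expTerm n r h k a = expTerm n r h k' a := by
  induction a with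
  | zero => rfl
  | succ a ih =>
    cases a with
    | zero => rfl
    | succ a =>
      rw [expTerm, expTerm, ih fun i hi => hk i (by omega), vertexFactor, vertexFactor,
        Nat.add_sub_cancel, hk a (by omega), hk (a + 1) (by omega)]

/-- The power E_a^{(k_{a-1})} is still waiting to merge at vertex a. At a = n + 1 it is trivial,
because k_n ≤ r_n = 0. -/
theorem partialElt_eq_sum (hr0 : r 0 = 0) (hrn : r n = 0)
    (hsparse : ∀ i, 1 ≤ i → i + 1 ≤ n → i ∉ Omega n h ∨ i + 1 ∉ Omega n h) (a : ℕ)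
    (ha : a ≤ n + 1) :
    partialElt n r h a =
      ∑ k ∈ seqBox r a, divPow (E n a) (k (a - 1)) * expTerm n r h k a := by
  induction a using Nat.strong_induction_on with
  | _ a ih =>
    rcases a with _ | _ | a
    · simp [partialElt, seqBox, expTerm, divPow_zero]
    · rw [sum_seqBox_succ]
      simp [partialElt, seqBox, expTerm, hr0, divPow_zero]
    have hcond : (1 ≤ a + 1 ∧ a + 1 + 1 ≤ n) ∨ r (a + 1) = 0 := by
      by_cases han : a + 2 ≤ n
      · exact Or.inl ⟨by omega, han⟩
      · right; rw [show a + 1 = n by omega]; exact hrn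
    by_cases hO : a + 1 ∈ Omega n h
    · have hh := (mem_Omega.1 hO).2
      rw [partialElt, if_pos hO, ih a (by omega) (by omega), sum_seqBox_succ, sum_seqBox_succ,
        Celt_succ (by
          rcases Nat.eq_zero_or_pos a with rfl | h0
          · exact Or.inr hr0
          · exact Or.inl ⟨h0, by omega⟩) (by omega), Finset.mul_sum]
      refine Finset.sum_congr rfl fun k hk => ?_
      rw [Finset.sum_mul]
      refine Finset.sum_congr rfl fun b hb => ?_
      rw [Finset.sum_mul]
      refine Finset.sum_congr rfl fun j hj => ?_
      set k' := Function.update (Function.update k a b) (a + 1) j with hk'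
      have k1 : k' (a + 1) = j := by simp [hk']
      have k2 : k' a = b := by simp [hk']
      have k3 : ∀ i < a, k' i = k i := fun i hi => by
        rw [hk', Function.update_of_ne (by omega), Function.update_of_ne (by omega)]
      rw [show a + 1 + 1 - 1 = a + 1 by omega, k1, expTerm, k1, k2, vertexFactor, if_neg hh, k1,
        Nat.add_sub_cancel, k2]
      -- At the first vertex nothing is pending, since r_0 = 0 forces b = 0.
      rcases a with _ | a
      · obtain rfl : b = 0 := by simpa [hr0] using hb
        obtain rfl : k = 0 := by simpa [seqBox] using hk
        simp [expTerm, divPow_zero, hr0]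
      · have ha0 : h (a + 1) = 0 := by
          by_contra h0
          rcases hsparse (a + 1) (by omega) (by omega) with h1 | h1
          · exact h1 (mem_Omega.2 ⟨by omega, h0⟩)
          · exact h1 hO
        -- The power E_{a+1}^{(b)} released by C_{a+2} meets the pending power. By sparsity a + 1 ∉
        -- Ω, so the resulting binomial is exactly the local factor there.
        have m1 := divPow_mul_divPow (E n (a + 1)) b (k a)
        have c1 : ∀ A B C D F G : Uplus n, A * (B * (C * D)) * (F * G) =
            A * (B * (C * (D * F) * G)) := by intros; simp only [mul_assoc]
        rw [expTerm, k2, k3 a (by omega), vertexFactor, if_pos ha0, k2, Nat.add_sub_cancel,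
          k3 a (by omega), expTerm_congr k3, smul_mul_assoc, c1, m1, ha0, zero_add, add_comm b,
          add_comm (b : ℤ)]
        simp only [mul_smul_comm, smul_mul_assoc, smul_smul]
        simp only [mul_assoc]
        congr 1
        ring
    · have hh : h (a + 1) = 0 := by
        by_contra h0
        exact hO (mem_Omega.2 ⟨by omega, h0⟩)
      rw [partialElt, if_neg hO, ih (a + 1) (by omega) (by omega), sum_seqBox_succ (a + 1),
        Finset.mul_sum]
      refine Finset.sum_congr rfl fun k hk => ?_
      rw [← mul_assoc, pairElt_mul_divPow _ hcond, Finset.sum_mul]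
      refine Finset.sum_congr rfl fun j hj => ?_
      have k3 : ∀ i < a + 1, Function.update k (a + 1) j i = k i := fun i hi => by
        rw [Function.update_of_ne (by omega)]
      rw [expTerm, expTerm_congr k3, vertexFactor, if_pos hh, Nat.add_sub_cancel,
        Nat.add_sub_cancel, k3 a (by omega), hh, Function.update_self, zero_add]
      simp only [mul_smul_comm, smul_mul_assoc, mul_assoc]

theorem expTerm_succ_eq (k : ℕ → ℕ) (a : ℕ) :
    expTerm n r h k (a + 1) = (∏ i ∈ Finset.Icc 1 a, vertexFactor h k i) •
      ((List.range' 1 a).reverse.map fun i =>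
        divPow (Eroot n i (i + 1)) ((r - k) i) * divPow (E n i) (dotPlus h k i)).prod := by
  induction a with
  | zero => simp [expTerm]
  | succ a ih =>
    rw [expTerm, ih, Finset.prod_Icc_succ_top (by omega), List.range'_concat, List.reverse_append,
      List.map_append, List.prod_append, smul_mul_smul_comm, mul_comm (vertexFactor _ _ _)]
    simp [dotPlus, add_comm 1 a]

theorem EOmega_eq_sum (hr0 : r 0 = 0) (hrn : r n = 0)
    (hsparse : ∀ i, 1 ≤ i → i + 1 ≤ n → i ∉ Omega n h ∨ i + 1 ∉ Omega n h) :
    EOmega n r h = ∑ k ∈ seqBox r (n + 1),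
      zetaCoeff n h k • pbw n (complexMult n (r - k) (dotPlus h k)) := by
  rw [EOmega_eq_partialElt hrn hsparse, partialElt_eq_sum hr0 hrn hsparse _ le_rfl]
  refine Finset.sum_congr rfl fun k hk => ?_
  have hkn : k n = 0 := by
    have := (mem_seqBox.1 hk).1 n (by omega)
    omega
  rw [Nat.add_sub_cancel, hkn, divPow_zero, one_mul, expTerm_succ_eq, zetaCoeff_eq_prod,
    pbw_complexMult _ _ _ (by simp [hrn]), Ecom]

/-- Since k ≤ r, the truncated difference r - k determines k at 0 < i < n, and at the two ends k
vanishes. Hence distinct k contribute distinct PBW elements. -/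
theorem complexMult_eq_iff {k k' : ℕ → ℕ} (hr0 : r 0 = 0) (hrn : r n = 0)
    (hk : ∀ i ≤ n, k i ≤ r i) (hk' : ∀ i ≤ n, k' i ≤ r i) :
    complexMult n (r - k) (dotPlus h k) = complexMult n (r - k') (dotPlus h k') ↔
      ∀ i ≤ n, k i = k' i := by
  constructor
  · intro he i hi
    have a1 := hk i hi
    have a2 := hk' i hi
    by_cases h0 : i = 0
    · subst h0; omega
    by_cases hn : i = n
    · subst hn; omega
    have := congrFun he ⟨(i, i + 1), by simp only; omega⟩
    simp [complexMult] at this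
    omega
  · intro he
    funext ⟨⟨i, j⟩, hp⟩
    simp only at hp
    simp [complexMult, dotPlus, he i (by omega), he (i - 1) (by omega)]

theorem zetaCoeff_congr {k k' : ℕ → ℕ} (hk : ∀ i ≤ n, k i = k' i) :
    zetaCoeff n h k = zetaCoeff n h k' := by
  rw [zetaCoeff_eq_prod, zetaCoeff_eq_prod]
  refine Finset.prod_congr rfl fun i hi => ?_
  have := Finset.mem_Icc.1 hi
  rw [vertexFactor, vertexFactor, hk i (by omega), hk (i - 1) (by omega)]

theorem exists_EOmega_expansion (hr0 : r 0 = 0) (hrn : r n = 0)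
    (hsparse : ∀ i, 1 ≤ i → i + 1 ≤ n → i ∉ Omega n h ∨ i + 1 ∉ Omega n h) :
    ∃ c : (PosRoot n → ℕ) →₀ K,
      Finsupp.linearCombination K (pbw n) c = EOmega n r h ∧
      (∀ k : ℕ → ℕ, k ≤ r →
        c (complexMult n (r - k) (dotPlus h k)) = zetaCoeff n h k) ∧
      (∀ m : PosRoot n → ℕ,
        (∀ k : ℕ → ℕ, k ≤ r → m ≠ complexMult n (r - k) (dotPlus h k)) → c m = 0) := by
  classical
  refine ⟨∑ k ∈ seqBox r (n + 1),
    Finsupp.single (complexMult n (r - k) (dotPlus h k)) (zetaCoeff n h k), ?_, ?_, ?_⟩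
  · simp [EOmega_eq_sum hr0 hrn hsparse, map_sum]
  · intro k hk
    -- Values beyond n are irrelevant; truncating them picks the representative in `seqBox`.
    set k₀ : ℕ → ℕ := fun i => if i ≤ n then k i else 0 with hk₀
    have hk₀n : ∀ i ≤ n, k₀ i = k i := fun i hi => if_pos hi
    have hmem : k₀ ∈ seqBox r (n + 1) := mem_seqBox.2
      ⟨fun i hi => by rw [hk₀n i (by omega)]; exact hk i, fun i hi => if_neg (by omega)⟩
    rw [Finsupp.finsetSum_apply, Finset.sum_eq_single_of_mem k₀ hmem]
    · rw [(complexMult_eq_iff hr0 hrn (fun i hi => by rw [hk₀n i hi]; exact hk i)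
        fun i _ => hk i).2 hk₀n, Finsupp.single_eq_same, zetaCoeff_congr hk₀n]
    · intro k' hk' hne
      refine Finsupp.single_eq_of_ne fun he => hne ?_
      rw [mem_seqBox] at hk'
      have := (complexMult_eq_iff hr0 hrn (fun i _ => hk i)
        fun i hi => hk'.1 i (by omega)).1 he
      funext i
      by_cases hi : i ≤ n
      · rw [hk₀n i hi, this i hi]
      · rw [hk'.2 i (by omega), hk₀]; exact (if_neg hi).symm
  · intro m hm
    rw [Finsupp.finsetSum_apply]
    refine Finset.sum_eq_zero fun k hk => Finsupp.single_eq_of_ne ?_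
    rw [mem_seqBox] at hk
    refine hm k fun i => ?_
    by_cases hi : i < n + 1
    · exact hk.1 i hi
    · rw [hk.2 i (by omega)]; exact Nat.zero_le _

end Expansion

/-! ### Additivity of the quantum Serre expression -/

section SerreSum

variable {F R : Type*} [Field F] [Ring R] [Algebra F R]

/-- The quantum Serre expression `x²y - (q + q⁻¹)xyx + yx²`. -/
def serreExpr (q : F) (x y : R) : R := x ^ 2 * y - (q + q⁻¹) • (x * y * x) + y * x ^ 2

/-- The mixed terms cancel as in the check that a coproduct respects the Serre relation. No relation
between B and b is needed, as the expression is linear in its second argument. -/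
theorem serreExpr_add {q : F} (hq : q ≠ 0) {A B a b : R} (hAa : A * a = q ^ 2 • (a * A))
    (hAb : A * b = q⁻¹ • (b * A)) (hBa : B * a = q⁻¹ • (a * B)) :
    serreExpr q (A + a) (B + b) = serreExpr q A B + serreExpr q a b := by
  have hAa' : ∀ w, A * (a * w) = q ^ 2 • (a * (A * w)) := fun w => by
    rw [← mul_assoc, hAa, smul_mul_assoc, mul_assoc]
  have hAb' : ∀ w, A * (b * w) = q⁻¹ • (b * (A * w)) := fun w => by
    rw [← mul_assoc, hAb, smul_mul_assoc, mul_assoc]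
  have hBa' : ∀ w, B * (a * w) = q⁻¹ • (a * (B * w)) := fun w => by
    rw [← mul_assoc, hBa, smul_mul_assoc, mul_assoc]
  simp only [serreExpr, pow_two, add_mul, mul_add, mul_assoc]
  simp only [hAa, hAb, hBa, hAa', hAb', hBa', mul_smul_comm, smul_smul]
  match_scalars <;> field_simp <;> ring

theorem serreExpr_sum {q : F} (hq : q ≠ 0) (A B : ℕ → R) (N : ℕ)
    (hAA : ∀ j l, j < l → l < N → A j * A l = q ^ 2 • (A l * A j))
    (hAB : ∀ j l, j < l → l < N → A j * B l = q⁻¹ • (B l * A j))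
    (hBA : ∀ j l, j < l → l < N → B j * A l = q⁻¹ • (A l * B j))
    (hS : ∀ j, serreExpr q (A j) (B j) = 0) :
    serreExpr q (∑ j ∈ Finset.range N, A j) (∑ j ∈ Finset.range N, B j) = 0 := by
  induction N with
  | zero => simp [serreExpr]
  | succ N ih =>
    have hN := Nat.lt_succ_self N
    rw [Finset.sum_range_succ, Finset.sum_range_succ, serreExpr_add hq,
      ih (fun j l h1 h2 => hAA j l h1 (h2.trans hN)) (fun j l h1 h2 => hAB j l h1 (h2.trans hN))
        (fun j l h1 h2 => hBA j l h1 (h2.trans hN)), hS, add_zero]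
    · rw [Finset.sum_mul, Finset.mul_sum, Finset.smul_sum]
      exact Finset.sum_congr rfl fun j hj => hAA j N (Finset.mem_range.1 hj) hN
    · rw [Finset.sum_mul, Finset.mul_sum, Finset.smul_sum]
      exact Finset.sum_congr rfl fun j hj => hAB j N (Finset.mem_range.1 hj) hN
    · rw [Finset.sum_mul, Finset.mul_sum, Finset.smul_sum]
      exact Finset.sum_congr rfl fun j hj => hBA j N (Finset.mem_range.1 hj) hN

end SerreSum

/-! ### The representation of U⁺ on monomials -/

/-- Exponent arrays `(m_{i,j})`. -/
abbrev Wt : Type := ℕ → ℕ → ℤ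

/-- The space with basis the monomials `x^m`. -/
abbrev MonoSpace : Type := Wt →₀ K

/-- The operator `x^m ↦ c(m) x^{m+d}`. -/
def wshift (d : Wt) (c : Wt → K) : Module.End K MonoSpace :=
  Finsupp.linearCombination K fun m => Finsupp.single (m + d) (c m)

theorem wshift_single (d : Wt) (c : Wt → K) (m : Wt) (a : K) :
    wshift d c (Finsupp.single m a) = Finsupp.single (m + d) (a * c m) := by
  simp [wshift]

/-- The exponent change of moving one box from row `i + 1` to row `i` in column `j`, or creating
a box at `(j, j)`. -/
def moveVec (i j : ℕ) : Wt := fun a b =>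
  if b = j then (if a = i then 1 else if a = i + 1 ∧ i < j then -1 else 0) else 0

/-- The total weight of the columns to the right of `j` for the simple root `i`. -/
def rightWt (n i j : ℕ) (m : Wt) : ℤ := ∑ l ∈ Finset.Ioc j n, (m i l - m (i + 1) l)

/-- The coefficient of the move in column `j`. -/
def moveCoeff (i j : ℕ) (m : Wt) : K :=
  if i < j then qint (m (i + 1) j) else if i = j then 1 else 0

/-- The action of `E_i` on the column `j`, twisted by the weight of the columns to its right. -/
def colOp (n i j : ℕ) : Module.End K MonoSpace :=
  wshift (moveVec i j) fun m => v ^ rightWt n i j m * moveCoeff i j m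

theorem colOp_single (n i j : ℕ) (m : Wt) (a : K) : colOp n i j (Finsupp.single m a) =
    Finsupp.single (m + moveVec i j) (a * (v ^ rightWt n i j m * moveCoeff i j m)) :=
  wshift_single _ _ _ _

theorem moveCoeff_add_of_ne {i j k l : ℕ} (hjl : j ≠ l) (m : Wt) :
    moveCoeff i j (m + moveVec k l) = moveCoeff i j m := by
  simp [moveCoeff, moveVec, hjl]

theorem rightWt_add_of_le {n i j k l : ℕ} (hlj : l ≤ j) (m : Wt) :
    rightWt n i j (m + moveVec k l) = rightWt n i j m := by
  refine Finset.sum_congr rfl fun b hb => ?_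
  have : b ≠ l := by have := Finset.mem_Ioc.1 hb; omega
  simp [moveVec, this]

theorem rightWt_add_of_lt {n i j k l : ℕ} (hjl : j < l) (hln : l ≤ n) (m : Wt) :
    rightWt n i j (m + moveVec k l) =
      rightWt n i j m + (moveVec k l i l - moveVec k l (i + 1) l) := by
  have h : ∀ b ∈ Finset.Ioc j n, (m + moveVec k l) i b - (m + moveVec k l) (i + 1) b =
      (m i b - m (i + 1) b) +
        if b = l then (moveVec k l i l - moveVec k l (i + 1) l) else 0 := by
    intro b _
    by_cases hb : b = l
    · subst hb; simp; ring
    · simp [moveVec, hb]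
  rw [rightWt, Finset.sum_congr rfl h, Finset.sum_add_distrib, Finset.sum_ite_eq',
    if_pos (Finset.mem_Ioc.2 ⟨hjl, hln⟩), rightWt]

/-- The Cartan matrix of type `A`. -/
def cartanA (i k : ℕ) : ℤ := if i = k then 2 else if i + 1 = k ∨ k + 1 = i then -1 else 0

theorem moveVec_sub {i j k l : ℕ} (hij : i ≤ j) (hjl : j < l) (hkl : k ≤ l) :
    moveVec k l i l - moveVec k l (i + 1) l = cartanA i k := by
  simp only [moveVec, cartanA, if_true]
  split_ifs <;> omega

/-- A move in column l changes the weight to the right of column j by the Cartan integer, while a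
move in column j is invisible to column l. Outside i ≤ j, k ≤ l one of the operators is zero. -/
theorem colOp_mul_colOp {n i j k l : ℕ} (hjl : j < l) (hln : l ≤ n) :
    colOp n i j * colOp n k l = v ^ cartanA i k • (colOp n k l * colOp n i j) := by
  refine Finsupp.lhom_ext fun m a => ?_
  rw [LinearMap.smul_apply, Module.End.mul_apply, Module.End.mul_apply, colOp_single, colOp_single,
    colOp_single, colOp_single, Finsupp.smul_single, moveCoeff_add_of_ne hjl.ne,
    moveCoeff_add_of_ne hjl.ne', rightWt_add_of_lt hjl hln, rightWt_add_of_le hjl.le,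
    add_right_comm m]
  congr 1
  by_cases hij : i ≤ j
  · by_cases hkl : k ≤ l
    · rw [moveVec_sub hij hjl hkl, zpow_add₀ v_ne_zero, smul_eq_mul]
      ring
    · have : moveCoeff k l m = 0 := by rw [moveCoeff, if_neg (by omega), if_neg (by omega)]
      simp [this]
  · have : moveCoeff i j m = 0 := by rw [moveCoeff, if_neg (by omega), if_neg (by omega)]
    simp [this]

theorem colOp_eq_zero {n i j : ℕ} (hij : j < i) : colOp n i j = 0 := by
  refine Finsupp.lhom_ext fun m a => ?_
  rw [colOp_single, moveCoeff, if_neg (by omega), if_neg (by omega)]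
  simp

theorem colOp_comm_self {n i j k : ℕ} (hik : i + 2 ≤ k ∨ k + 2 ≤ i) :
    colOp n i j * colOp n k j = colOp n k j * colOp n i j := by
  refine Finsupp.lhom_ext fun m a => ?_
  have h1 : moveCoeff i j (m + moveVec k j) = moveCoeff i j m := by
    have h : moveVec k j (i + 1) j = 0 := by
      rw [moveVec, if_pos rfl, if_neg (by omega), if_neg (by omega)]
    simp [moveCoeff, h]
  have h2 : moveCoeff k j (m + moveVec i j) = moveCoeff k j m := by
    have h : moveVec i j (k + 1) j = 0 := by
      rw [moveVec, if_pos rfl, if_neg (by omega), if_neg (by omega)]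
    simp [moveCoeff, h]
  rw [Module.End.mul_apply, Module.End.mul_apply, colOp_single, colOp_single,
    colOp_single, colOp_single, rightWt_add_of_le le_rfl, rightWt_add_of_le le_rfl, h1, h2,
    add_right_comm m]
  congr 1
  ring

theorem moveCoeff_add_self {i j : ℕ} (hij : i < j) (m : Wt) :
    moveCoeff i j (m + moveVec i j) = qint (m (i + 1) j - 1) := by
  simp [moveCoeff, hij, moveVec, sub_eq_add_neg]

theorem moveCoeff_add_succ {i j : ℕ} (hij : i < j) (m : Wt) :
    moveCoeff i j (m + moveVec (i + 1) j) = qint (m (i + 1) j + 1) := by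
  simp [moveCoeff, hij, moveVec]

theorem moveCoeff_succ_add {i j : ℕ} (m : Wt) :
    moveCoeff (i + 1) j (m + moveVec i j) = moveCoeff (i + 1) j m := by
  simp [moveCoeff, moveVec, show i + 1 + 1 ≠ i by omega]

/-- The twist is constant within a column. With x = m_{i+1,j} the three terms give [x]([x+1] -
[2][x] + [x-1]) = 0. -/
theorem serreExpr_colOp_succ (n i j : ℕ) :
    serreExpr v (colOp n i j) (colOp n (i + 1) j) = 0 := by
  by_cases hij : i < j
  swap
  · rw [colOp_eq_zero (show j < i + 1 by omega)]; simp [serreExpr]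
  refine Finsupp.lhom_ext fun m a => ?_
  have e0 : moveCoeff i j m = qint (m (i + 1) j) := if_pos hij
  have v2 : moveVec (i + 1) j (i + 1) j = 1 := by simp [moveVec]
  rw [serreExpr]
  simp only [pow_two, LinearMap.add_apply, LinearMap.sub_apply, LinearMap.smul_apply,
    Module.End.mul_apply, colOp_single, rightWt_add_of_le le_rfl, LinearMap.zero_apply,
    Finsupp.smul_single, smul_eq_mul]
  rw [add_right_comm m (moveVec i j) (moveVec (i + 1) j),
    add_right_comm (m + moveVec i j) (moveVec i j) (moveVec (i + 1) j),
    add_right_comm m (moveVec i j) (moveVec (i + 1) j), ← Finsupp.single_sub, ← Finsupp.single_add,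
    Finsupp.single_eq_zero]
  simp only [moveCoeff_add_self hij, moveCoeff_add_succ hij, moveCoeff_succ_add, e0,
    Pi.add_apply, v2]
  rw [show m (i + 1) j + 1 - 1 = m (i + 1) j by ring]
  have := qint_three_term (m (i + 1) j)
  linear_combination (a * v ^ rightWt n i j m * v ^ rightWt n i j m * v ^ rightWt n (i + 1) j m *
    moveCoeff (i + 1) j m * qint (m (i + 1) j)) * this

theorem serreExpr_colOp_pred (n i j : ℕ) :
    serreExpr v (colOp n (i + 1) j) (colOp n i j) = 0 := by
  by_cases hij : i < j
  swap
  · rw [colOp_eq_zero (show j < i + 1 by omega)]; simp [serreExpr]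
  refine Finsupp.lhom_ext fun m a => ?_
  have e0 : moveCoeff i j m = qint (m (i + 1) j) := if_pos hij
  have v2 : moveVec (i + 1) j (i + 1) j = 1 := by simp [moveVec]
  rw [serreExpr]
  simp only [pow_two, LinearMap.add_apply, LinearMap.sub_apply, LinearMap.smul_apply,
    Module.End.mul_apply, colOp_single, rightWt_add_of_le le_rfl, LinearMap.zero_apply,
    Finsupp.smul_single, smul_eq_mul]
  rw [add_right_comm m (moveVec i j) (moveVec (i + 1) j),
    add_right_comm (m + moveVec (i + 1) j) (moveVec i j) (moveVec (i + 1) j),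
    ← Finsupp.single_sub, ← Finsupp.single_add, Finsupp.single_eq_zero]
  simp only [moveCoeff_add_succ hij, moveCoeff_succ_add, e0, Pi.add_apply, v2]
  have := qint_three_term (m (i + 1) j + 1)
  rw [add_sub_cancel_right] at this
  linear_combination (a * v ^ rightWt n i j m * v ^ rightWt n (i + 1) j m *
    v ^ rightWt n (i + 1) j m * moveCoeff (i + 1) j m *
    moveCoeff (i + 1) j (m + moveVec (i + 1) j)) * this

/-- The operator by which `E_i` acts. -/
def genOp (n i : ℕ) : Module.End K MonoSpace := ∑ j ∈ Finset.range (n + 1), colOp n i j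

theorem serreExpr_genOp {n i k : ℕ} (hik : i + 1 = k ∨ k + 1 = i) :
    serreExpr v (genOp n i) (genOp n k) = 0 := by
  have c1 : cartanA i i = (2 : ℕ) := by simp [cartanA]
  have c2 : cartanA i k = -1 := by simp only [cartanA]; split_ifs <;> omega
  have c3 : cartanA k i = -1 := by simp only [cartanA]; split_ifs <;> omega
  refine serreExpr_sum v_ne_zero _ _ _ (fun j l h1 h2 => ?_) (fun j l h1 h2 => ?_)
    (fun j l h1 h2 => ?_) fun j => ?_
  · rw [colOp_mul_colOp h1 (Nat.lt_succ_iff.1 h2), c1, zpow_natCast]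
  · rw [colOp_mul_colOp h1 (Nat.lt_succ_iff.1 h2), c2, zpow_neg_one]
  · rw [colOp_mul_colOp h1 (Nat.lt_succ_iff.1 h2), c3, zpow_neg_one]
  · rcases hik with rfl | rfl
    · exact serreExpr_colOp_succ n i j
    · exact serreExpr_colOp_pred n k j

theorem genOp_comm {n i k : ℕ} (hik : i + 2 ≤ k ∨ k + 2 ≤ i) :
    genOp n i * genOp n k = genOp n k * genOp n i := by
  refine Commute.sum_left _ _ _ fun j hj => Commute.sum_right _ _ _ fun l hl => ?_
  rw [Finset.mem_range] at hj hl
  have c1 : cartanA i k = 0 := by simp only [cartanA]; split_ifs <;> omega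
  have c2 : cartanA k i = 0 := by simp only [cartanA]; split_ifs <;> omega
  rcases lt_trichotomy j l with h | rfl | h
  · have := colOp_mul_colOp (i := i) (k := k) h (Nat.lt_succ_iff.1 hl)
    rwa [c1, zpow_zero, one_smul] at this
  · exact colOp_comm_self hik
  · have := colOp_mul_colOp (i := k) (k := i) h (Nat.lt_succ_iff.1 hj)
    rw [c2, zpow_zero, one_smul] at this
    exact this.symm

/-- The representation of `U⁺` on the space of monomials. -/
def rho (n : ℕ) : Uplus n →ₐ[K] Module.End K MonoSpace :=
  RingQuot.liftAlgHom K ⟨FreeAlgebra.lift K fun i : Vertex n => genOp n i.1, fun x y hxy => by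
    cases hxy with
    | comm i j hij =>
      simp only [map_mul, FreeAlgebra.lift_ι_apply]
      exact genOp_comm hij
    | serre i j hij =>
      simp only [map_add, map_sub, map_smul, map_mul, map_pow, map_zero, FreeAlgebra.lift_ι_apply]
      exact serreExpr_genOp hij⟩

theorem rho_E {n i : ℕ} (hi : 1 ≤ i ∧ i ≤ n) : rho n (E n i) = genOp n i := by
  rw [E, dif_pos hi, rho, RingQuot.liftAlgHom_mkAlgHom_apply, FreeAlgebra.lift_ι_apply]

/-! ### PBW elements acting on x^0, and linear independence -/

/-- The exponent array of the single variable `x_{i,j}`. -/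
def unitVec (i j : ℕ) : Wt := fun a b => if a = i ∧ b = j then 1 else 0

/-- The array `w` vanishes at all positions after `(i,j)` in lexicographic order. -/
def VanishesAfter (i j : ℕ) (w : Wt) : Prop :=
  (∀ a b, i < a → w a b = 0) ∧ ∀ b, j < b → w i b = 0

theorem VanishesAfter.add_unitVec {i j : ℕ} {w : Wt} (hw : VanishesAfter i j w) :
    VanishesAfter i j (w + unitVec i j) := by
  refine ⟨fun a b hab => ?_, fun b hb => ?_⟩
  · have : a ≠ i := by omega
    simp [unitVec, hw.1 a b hab, this]
  · have : b ≠ j := by omega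
    simp [unitVec, hw.2 b hb, this]

theorem VanishesAfter.add_diag {i j : ℕ} {w : Wt} (hw : VanishesAfter i j w) :
    VanishesAfter (i + 1) j (w + unitVec i i) := by
  refine ⟨fun a b hab => ?_, fun b hb => ?_⟩
  · have : a ≠ i := by omega
    simp [unitVec, hw.1 a b (by omega), this]
  · simp [unitVec, hw.1 (i + 1) b (by omega)]

theorem genOp_single {n i : ℕ} (m : Wt) (a : K) : genOp n i (Finsupp.single m a) =
    ∑ j ∈ Finset.range (n + 1),
      Finsupp.single (m + moveVec i j) (a * (v ^ rightWt n i j m * moveCoeff i j m)) := by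
  simp only [genOp, LinearMap.sum_apply, colOp_single]

theorem moveVec_self (i : ℕ) : moveVec i i = unitVec i i := by
  funext a b
  simp only [moveVec, unitVec]
  split_ifs <;> omega

theorem moveCoeff_self (i : ℕ) (m : Wt) : moveCoeff i i m = 1 := by simp [moveCoeff]

theorem moveCoeff_eq_zero {i j : ℕ} {m : Wt} (hij : i ≠ j) (hm : i < j → m (i + 1) j = 0) :
    moveCoeff i j m = 0 := by
  rw [moveCoeff]
  split_ifs with h
  · rw [hm h, qint_zero]
  · rfl

theorem genOp_single_of_vanishes {n i : ℕ} (hi : i ≤ n) {w : Wt}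
    (hw : ∀ a b, i < a → w a b = 0) (c : K) : genOp n i (Finsupp.single w c) =
      Finsupp.single (w + unitVec i i) (c * v ^ (∑ l ∈ Finset.Ioc i n, w i l)) := by
  rw [genOp_single, Finset.sum_eq_single_of_mem i (Finset.mem_range.2 (by omega))]
  · rw [moveVec_self, moveCoeff_self, mul_one, rightWt]
    simp [hw (i + 1)]
  · intro j _ hj
    rw [moveCoeff_eq_zero hj.symm fun _ => hw _ _ (by omega)]
    simp

theorem genOp_single_add_unitVec {n i j : ℕ} (hij : i < j) (hj : j ≤ n) {w : Wt}
    (hw : VanishesAfter i j w) (c : K) :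
    genOp n i (Finsupp.single (w + unitVec (i + 1) j) c) =
      Finsupp.single (w + unitVec i j) c +
        Finsupp.single (w + unitVec i i + unitVec (i + 1) j)
          (v⁻¹ * (c * v ^ (∑ l ∈ Finset.Ioc i n, w i l))) := by
  have w1 : ∀ b, w (i + 1) b = 0 := fun b => hw.1 _ _ (by omega)
  rw [genOp_single, Finset.sum_eq_add_of_mem j i (Finset.mem_range.2 (by omega))
    (Finset.mem_range.2 (by omega)) hij.ne']
  · congr 1
    · have h1 : w + unitVec (i + 1) j + moveVec i j = w + unitVec i j := by
        funext a b
        simp only [Pi.add_apply, unitVec, moveVec]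
        split_ifs <;> omega
      have h2 : rightWt n i j (w + unitVec (i + 1) j) = 0 := by
        refine Finset.sum_eq_zero fun b hb => ?_
        have hb' : j < b := (Finset.mem_Ioc.1 hb).1
        simp [unitVec, w1, hw.2 b hb', hb'.ne']
      have h3 : moveCoeff i j (w + unitVec (i + 1) j) = 1 := by
        simp [moveCoeff, hij, unitVec, w1, qint_one]
      rw [h1, h2, h3]; simp
    · have h2 : rightWt n i i (w + unitVec (i + 1) j) = -1 + ∑ l ∈ Finset.Ioc i n, w i l := by
        have : ∀ l ∈ Finset.Ioc i n, (w + unitVec (i + 1) j) i l -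
            (w + unitVec (i + 1) j) (i + 1) l = (if l = j then -1 else 0) + w i l := by
          intro l _
          by_cases hl : l = j
          · simp [w1, unitVec, hl]; ring
          · simp [w1, unitVec, hl]
        rw [rightWt, Finset.sum_congr rfl this, Finset.sum_add_distrib, Finset.sum_ite_eq',
          if_pos (Finset.mem_Ioc.2 ⟨hij, hj⟩)]
      rw [moveVec_self, moveCoeff_self, h2, zpow_add₀ v_ne_zero, zpow_neg_one, add_right_comm]
      congr 1
      ring
  · intro l _ hl
    rw [moveCoeff_eq_zero hl.2.symm]
    · simp
    · intro _
      simp [unitVec, w1, hl.1]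

/-- In E_i E_{i+1,j} - v⁻¹ E_{i+1,j} E_i both products create the array with new boxes at (i,i) and
(i+1,j), and these terms cancel. What remains moves the new box from (i+1,j) to (i,j), with
coefficient 1 since nothing lies after (i,j). -/
theorem rho_rootElt_single {n : ℕ} (l : ℕ) : ∀ {i : ℕ} {w : Wt}, 1 ≤ i → i + l ≤ n →
    VanishesAfter i (i + l) w → ∀ c : K,
    rho n (rootElt n i l) (Finsupp.single w c) = Finsupp.single (w + unitVec i (i + l)) c := by
  induction l with
  | zero =>
    intro i w hi hn hw c
    rw [add_zero] at *
    rw [rootElt, rho_E ⟨hi, hn⟩, genOp_single_of_vanishes hn hw.1]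
    have : ∑ l ∈ Finset.Ioc i n, w i l = 0 :=
      Finset.sum_eq_zero fun b hb => hw.2 b (Finset.mem_Ioc.1 hb).1
    rw [this]; simp
  | succ l ih =>
    intro i w hi hn hw c
    have e : i + (l + 1) = i + 1 + l := by ring
    rw [e] at hn hw ⊢
    have hw' : VanishesAfter (i + 1) (i + 1 + l) w :=
      ⟨fun a b hab => hw.1 a b (by omega), fun b _ => hw.1 _ b (by omega)⟩
    rw [rootElt, map_sub, map_smul, map_mul, map_mul, LinearMap.sub_apply, LinearMap.smul_apply,
      Module.End.mul_apply, Module.End.mul_apply, ih (by omega) hn hw', rho_E ⟨hi, by omega⟩,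
      genOp_single_of_vanishes (by omega) hw.1, ih (by omega) hn hw.add_diag,
      genOp_single_add_unitVec (by omega) hn hw, Finsupp.smul_single, smul_eq_mul,
      add_sub_cancel_right]

theorem VanishesAfter.add_nsmul {i j : ℕ} {w : Wt} (hw : VanishesAfter i j w) (p : ℕ) :
    VanishesAfter i j (w + p • unitVec i j) := by
  induction p with
  | zero => simpa
  | succ p ih => rw [succ_nsmul, ← add_assoc]; exact ih.add_unitVec

theorem rho_divPow_single {n i j : ℕ} (hi : 1 ≤ i) (hij : i ≤ j) (hj : j ≤ n) {w : Wt}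
    (hw : VanishesAfter i j w) (p : ℕ) (c : K) :
    rho n (divPow (Eroot n i j) p) (Finsupp.single w c) =
      Finsupp.single (w + p • unitVec i j) ((qfact p)⁻¹ * c) := by
  have h : rho n (Eroot n i j ^ p) (Finsupp.single w c) =
      Finsupp.single (w + p • unitVec i j) c := by
    induction p with
    | zero => simp
    | succ p ih =>
      have e : i + (j - i) = j := by omega
      have := rho_rootElt_single (n := n) (j - i) hi (by omega) (by rw [e]; exact hw.add_nsmul p) c
      rw [pow_succ', map_mul, Module.End.mul_apply, ih, Eroot, this, e, succ_nsmul, add_assoc]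
  rw [divPow, map_smul, LinearMap.smul_apply, h, Finsupp.smul_single, smul_eq_mul]

/-- The multiplicities `m_{a,b}` at the positions `(a,b)` before `(i,j)` in lexicographic order. -/
def initialWt {n : ℕ} (m : PosRoot n → ℕ) (i j : ℕ) : Wt := fun a b =>
  if a < i ∨ (a = i ∧ b < j) then (mult m a b : ℤ) else 0

theorem mult_eq_zero {n : ℕ} (m : PosRoot n → ℕ) {i j : ℕ} (h : ¬ (1 ≤ i ∧ i ≤ j ∧ j ≤ n)) :
    mult m i j = 0 := dif_neg h

theorem vanishesAfter_initialWt {n : ℕ} (m : PosRoot n → ℕ) (i j : ℕ) :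
    VanishesAfter i j (initialWt m i j) :=
  ⟨fun a b hab => if_neg (by omega), fun b hb => if_neg (by omega)⟩

theorem initialWt_add {n : ℕ} (m : PosRoot n → ℕ) (i j : ℕ) :
    initialWt m i j + mult m i j • unitVec i j = initialWt m i (j + 1) := by
  funext a b
  simp only [initialWt, unitVec, Pi.add_apply, Pi.smul_apply]
  by_cases h : a = i ∧ b = j
  · obtain ⟨rfl, rfl⟩ := h
    simp
  · rw [if_neg h, smul_zero, add_zero]
    refine if_congr ?_ rfl rfl
    omega

theorem initialWt_row_succ {n : ℕ} (m : PosRoot n → ℕ) (i : ℕ) :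
    initialWt m i (n + 1) = initialWt m (i + 1) (i + 1) := by
  funext a b
  simp only [initialWt]
  by_cases h : 1 ≤ a ∧ a ≤ b ∧ b ≤ n
  · refine if_congr ?_ rfl rfl
    omega
  · simp [mult_eq_zero m h]

theorem initialWt_row_start {n : ℕ} (m : PosRoot n → ℕ) : initialWt m 1 1 = 0 := by
  funext a b
  simp only [initialWt]
  by_cases h : 1 ≤ a ∧ a ≤ b ∧ b ≤ n
  · exact if_neg (by omega)
  · simp [mult_eq_zero m h]

theorem rho_pbw_row {n : ℕ} (m : PosRoot n → ℕ) {i : ℕ} (hi : 1 ≤ i) (l : ℕ) (hl : i + l ≤ n + 1) :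
    ∃ c : K, c ≠ 0 ∧ ∀ a : K, rho n ((List.range' i l).reverse.map fun j =>
        divPow (Eroot n i j) (mult m i j)).prod (Finsupp.single (initialWt m i i) a) =
      Finsupp.single (initialWt m i (i + l)) (c * a) := by
  induction l with
  | zero => exact ⟨1, one_ne_zero, fun a => by simp⟩
  | succ l ih =>
    obtain ⟨c, hc, h⟩ := ih (by omega)
    refine ⟨(qfact (mult m i (i + l)))⁻¹ * c, mul_ne_zero (inv_ne_zero (qfact_ne_zero _)) hc,
      fun a => ?_⟩
    rw [List.range'_concat, one_mul, List.reverse_append, List.map_append, List.prod_append,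
      map_mul, Module.End.mul_apply, h]
    simp only [List.reverse_singleton, List.map_singleton, List.prod_singleton]
    rw [rho_divPow_single hi (by omega) (by omega) (vanishesAfter_initialWt m _ _), initialWt_add,
      mul_assoc, add_assoc]

/-- Read from the right, the factors of a PBW element occur in increasing lexicographic order of
(i,j), so each one acts on an array that vanishes after its own position. -/
theorem rho_pbw {n : ℕ} (m : PosRoot n → ℕ) :
    ∃ c : K, c ≠ 0 ∧ rho n (pbw n m) (Finsupp.single 0 1) =
      Finsupp.single (initialWt m (n + 1) (n + 1)) c := by
  have key : ∀ l ≤ n, ∃ c : K, c ≠ 0 ∧ rho n ((List.range' 1 l).reverse.map fun i =>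
      ((List.range' i (n + 1 - i)).reverse.map fun j =>
        divPow (Eroot n i j) (mult m i j)).prod).prod (Finsupp.single 0 1) =
      Finsupp.single (initialWt m (l + 1) (l + 1)) c := by
    intro l hl
    induction l with
    | zero => exact ⟨1, one_ne_zero, by simp [initialWt_row_start]⟩
    | succ l ih =>
      obtain ⟨c, hc, h⟩ := ih (by omega)
      obtain ⟨c', hc', h'⟩ := rho_pbw_row m (i := l + 1) (by omega) (n + 1 - (l + 1)) (by omega)
      refine ⟨c' * c, mul_ne_zero hc' hc, ?_⟩
      rw [List.range'_concat, List.reverse_append, List.map_append, List.prod_append, map_mul,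
        Module.End.mul_apply, h, one_mul, add_comm 1 l]
      simp only [List.reverse_singleton, List.map_singleton, List.prod_singleton]
      rw [h', show l + 1 + (n + 1 - (l + 1)) = n + 1 by omega, initialWt_row_succ]
  exact key n le_rfl

theorem linearIndependent_pbw (n : ℕ) : LinearIndependent K (pbw n) := by
  choose c hc h using fun m : PosRoot n → ℕ => rho_pbw m
  let f : Uplus n →ₗ[K] MonoSpace :=
    (LinearMap.applyₗ (Finsupp.single (0 : Wt) (1 : K))).comp (rho n).toLinearMap
  refine LinearIndependent.of_comp f ?_
  have hinj : Function.Injective fun m : PosRoot n → ℕ => initialWt m (n + 1) (n + 1) := by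
    intro m m' he
    funext ⟨⟨i, j⟩, hp⟩
    have := congrFun (congrFun he i) j
    simp only at hp
    simp only [initialWt] at this
    rw [if_pos (by omega), if_pos (by omega), mult, mult, dif_pos hp, dif_pos hp] at this
    exact_mod_cast this
  have h1 := (Finsupp.basisSingleOne (R := K) (ι := Wt)).linearIndependent.comp _ hinj
  have h2 := h1.units_smul fun m => Units.mk0 (c m) (hc m)
  convert! h2 using 1
  funext m
  simp only [Function.comp_apply, f, LinearMap.comp_apply, AlgHom.toLinearMap_apply,
    LinearMap.applyₗ_apply_apply, h, Pi.smul_apply', Units.smul_mk0, Finsupp.coe_basisSingleOne, Finsupp.smul_single,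
    smul_eq_mul, mul_one]

end VarCom

end

theorem mainTheorem3 (n : ℕ) (r h : ℕ → ℕ) (hr0 : r 0 = 0) (hrn : r n = 0)
    (hsparse : ∀ i, 1 ≤ i → i + 1 ≤ n →
      i ∉ VarCom.Omega n h ∨ i + 1 ∉ VarCom.Omega n h) :
    LinearIndependent VarCom.K (VarCom.pbw n) ∧
    ∃ c : (VarCom.PosRoot n → ℕ) →₀ VarCom.K,
      Finsupp.linearCombination VarCom.K (VarCom.pbw n) c = VarCom.EOmega n r h ∧
      (∀ k : ℕ → ℕ, k ≤ r →
        c (VarCom.complexMult n (r - k) (VarCom.dotPlus h k)) = VarCom.zetaCoeff n h k) ∧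
      (∀ m : VarCom.PosRoot n → ℕ,
        (∀ k : ℕ → ℕ, k ≤ r → m ≠ VarCom.complexMult n (r - k) (VarCom.dotPlus h k)) →
        c m = 0) :=
  ⟨VarCom.linearIndependent_pbw n, VarCom.exists_EOmega_expansion hr0 hrn hsparse⟩
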